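/- Conventions. All groups are finite, and $G$ is a finite group. For $K\le G$, $\operatorname{Irr}K$ is the set of complex irreducible characters of $K$; $\ker\chi=\{g:\chi(g)=\chi(1)\}$; $\psi^{L}$ is the character of $L$ induced by $\psi$; for $x$ normalizing $K$ and a character $\psi$ of $K$, $\psi^{x}(g)=\psi(xgx^{-1})$. $\operatorname{Aut}(\mathbb C)$ is the group of field automorphisms of $\mathbb C$. Let $\mathcal C$ be the class of finite groups $G$ such that every quotient of every subgroup of $G$ either is abelian or has a non-central abelian normal subgroup. For a normal subgroup $N$ of $G$, an $N$-linear character triple of $G$ is a triple $(H,A,\vartheta)$ with $A\unlhd H\le G$, $\vartheta\in\operatorname{Irr}A$ linear and invariant in $H$, and $\ker\vartheta^{G}=N$. For $A\le H\le G$ and a linear $\vartheta\in\operatorname{Irr}A$, let $\widetilde{\operatorname{Irr}}(H|\vartheta)$ be the set of $\psi\in\operatorname{Irr}H$ such that $\vartheta$ is a constituent of the restriction $\psi_A$ and $\ker\psi^{G}=N$, and let $\widetilde{\operatorname{Lin}}(H|\vartheta)$ be the set of linear characters in it. Given an $N$-linear character triple $(H,A,\vartheta)$ with $H\ne A$, let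 $\mathcal A$ be any normal subgroup of $H$ containing $\ker\vartheta$ with $\mathcal A/\ker\vartheta$ abelian, of maximal order among such subgroups. The group of automorphisms of $\mathbb C$ fixing $\mathbb Q(\vartheta)$ elementwise and the group $H$ act on $\widetilde{\operatorname{Lin}}(\mathcal A|\vartheta)$ by $\varphi\mapsto\sigma\circ\varphi$ and $\varphi\mapsto\varphi^{h}$; let $R$ be any set of representatives of the distinct orbits of this double action. Put $I_H(\varphi)=\{g\in H:\varphi^{g}=\varphi\}$ and $$Cl(H,A,\vartheta)=\{(I_H(\varphi),\mathcal A,\varphi):\varphi\in R\}$$ (the direct Clifford correspondents of $(H,A,\vartheta)$). **Theorem.** Let $G\in\mathcal C$, let $N\unlhd G$, and let $(H,A,\vartheta)$ be an $N$-linear character triple of $G$ with $H\neq A$; let $\mathcal A$, $R$ and $Cl(H,A,\vartheta)$ be as above. (i) For every $(I_H(\varphi),\mathcal A,\varphi)\in Cl(H,A,\vartheta)$: (a) $A\lneq\mathcal A$; furthermore, $\mathcal A=H=I_H(\varphi)$ if and only if $H/\ker\vartheta$ is abelian; (b) $I_H(\varphi)\unlhd N_H(\ker\varphi)$; (c) induction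 $\psi\mapsto\psi^{H}$ defines an injective map from $\widetilde{\operatorname{Irr}}(I_H(\varphi)|\varphi)$ to $\widetilde{\operatorname{Irr}}(H|\vartheta)$. (ii) For every $\chi\in\widetilde{\operatorname{Irr}}(H|\vartheta)$ there are $(I_H(\varphi),\mathcal A,\varphi)\in Cl(H,A,\vartheta)$, $\psi\in\widetilde{\operatorname{Irr}}(I_H(\varphi)|\varphi)$ and $\sigma\in\operatorname{Aut}(\mathbb C)$ with $\chi=\sigma\circ\psi^{H}$. (iii) If $(I_H(\varphi_1),\mathcal A,\varphi_1),(I_H(\varphi_2),\mathcal A,\varphi_2)\in Cl(H,A,\vartheta)$, $\psi_i\in\widetilde{\operatorname{Irr}}(I_H(\varphi_i)|\varphi_i)$ for $i=1,2$, and $\sigma\in\operatorname{Aut}(\mathbb C)$ satisfy $\psi_2^{H}=\sigma\circ\psi_1^{H}$, then $\varphi_1=\varphi_2$ $(=\varphi$, say$)$, and $\psi_2=\sigma\circ\psi_1^{x}$ for some $x\in N_H(\ker\varphi)$. -/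

import Mathlib

noncomputable section

namespace NLin

variable {G : Type*} [Group G]

/-- A group is abelian, or it has a non-central abelian normal subgroup. -/
def AbelianOrNoncentralAbelianNormal (Q : Type*) [Group Q] : Prop :=
  (∀ a b : Q, a * b = b * a) ∨
    ∃ B : Subgroup Q, B.Normal ∧ (∀ a ∈ B, ∀ b ∈ B, a * b = b * a) ∧ ¬ B ≤ Subgroup.center Q

/-- The class of groups all of whose sections (quotients `H ⧸ K` of subgroups `H`) are abelian or
have a non-central abelian normal subgroup.  The choices `K = ⊥` and `H = ⊤` give all subgroups
and all quotient groups of `G`. -/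
def InClassC (G : Type*) [Group G] : Prop :=
  ∀ (H : Subgroup G) (K : Subgroup H) [K.Normal], AbelianOrNoncentralAbelianNormal (H ⧸ K)

/-- `K ⊴ L` for two subgroups of `G`. -/
def NormalIn (K L : Subgroup G) : Prop :=
  K ≤ L ∧ (K.subgroupOf L).Normal

/-- The set of complex irreducible characters of a subgroup `K`.
Every finite dimensional complex representation is isomorphic to one on some `ℂ ^ n`. -/
def Irr (K : Subgroup G) : Set (K → ℂ) :=
  {χ | ∃ (n : ℕ) (ρ : Representation ℂ K (Fin n → ℂ)), ρ.IsIrreducible ∧ χ = ρ.character}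

/-- The kernel `{g ∈ K | χ g = χ 1}` of a character `χ` of a subgroup `K` of `G`,
as a subset of `G`. -/
def charKer {K : Subgroup G} (χ : K → ℂ) : Set G :=
  {g | ∃ hg : g ∈ K, χ ⟨g, hg⟩ = χ 1}

/-- For `K ≤ L`, the character of `L` induced by the character `ψ` of `K`:
`ψ ^ L (g) = |K|⁻¹ ∑_{x ∈ L} ψ°(x g x⁻¹)`, where `ψ°` is `ψ` on `K` and zero outside `K`. -/
def indChar {K : Subgroup G} (ψ : K → ℂ) (L : Subgroup G) : L → ℂ := fun g =>
  open Classical in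
  (Nat.card K : ℂ)⁻¹ *
    ∑ᶠ x : L, if h : (x : G) * g * (x : G)⁻¹ ∈ K then ψ ⟨(x : G) * g * (x : G)⁻¹, h⟩ else 0

/-- The usual hermitian inner product of complex functions on `K`. -/
def charInner {K : Subgroup G} (χ ψ : K → ℂ) : ℂ :=
  (Nat.card K : ℂ)⁻¹ * ∑ᶠ k : K, χ k * starRingEnd ℂ (ψ k)

/-- `χ` (a character of `H`) lies above `θ` (an irreducible character of the subgroup `A` of `H`):
the restriction `χ_A` has `θ` as a constituent. -/
def LiesAbove {H A : Subgroup G} (χ : H → ℂ) (θ : A → ℂ) : Prop :=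
  ∃ hA : A ≤ H, charInner (χ ∘ Subgroup.inclusion hA) θ ≠ 0

/-- The conjugate `ψ ^ x : g ↦ ψ (x g x⁻¹)`, for `x` normalizing `K`, so that `K ^ x = K`. -/
def conjChar {K : Subgroup G} (ψ : K → ℂ) (x : G)
    (hx : x ∈ Subgroup.normalizer (K : Set G)) : K → ℂ := fun g =>
  ψ ⟨x * g * x⁻¹, (Subgroup.mem_normalizer_iff.mp hx g).mp g.2⟩

/-- The inertia group `I_H(φ) = {g ∈ H | φ ^ g = φ}`. -/
def inertia (H : Subgroup G) {A : Subgroup G} (φ : A → ℂ) : Subgroup G where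
  carrier := {g | g ∈ H ∧ ∃ hg : g ∈ Subgroup.normalizer (A : Set G), conjChar φ g hg = φ}
  one_mem' := ⟨H.one_mem, Subgroup.one_mem _, by funext a; simp [conjChar]⟩
  mul_mem' := by
    rintro g h ⟨hgH, hg, eg⟩ ⟨hhH, hh, eh⟩
    refine ⟨H.mul_mem hgH hhH, Subgroup.mul_mem _ hg hh, ?_⟩
    funext a
    have e1 := congrFun eh a
    have e2 := congrFun eg ⟨h * a * h⁻¹, (Subgroup.mem_normalizer_iff.mp hh a).mp a.2⟩
    simp only [conjChar] at e1 e2 ⊢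
    rw [← e1, ← e2]
    congr 2
    group
  inv_mem' := by
    rintro g ⟨hgH, hg, eg⟩
    refine ⟨H.inv_mem hgH, Subgroup.inv_mem _ hg, ?_⟩
    funext a
    have e2 := congrFun eg ⟨g⁻¹ * a * (g⁻¹)⁻¹,
      (Subgroup.mem_normalizer_iff.mp (Subgroup.inv_mem _ hg) a).mp a.2⟩
    simp only [conjChar] at e2 ⊢
    rw [← e2]
    congr 1
    ext
    simp only
    group

/-- Data `(H, A, θ)`: subgroups `H` and `A` of `G` and a function `θ` on `A`. -/
structure Triple (G : Type*) [Group G] where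
  H : Subgroup G
  A : Subgroup G
  θ : A → ℂ

/-- `(H, A, θ)` is a character triple: `A ⊴ H` and `θ ∈ Irr A` is invariant in `H`. -/
def Triple.IsCharTriple (T : Triple G) : Prop :=
  NormalIn T.A T.H ∧ T.θ ∈ Irr T.A ∧
    ∀ h ∈ T.H, ∃ hn : h ∈ Subgroup.normalizer (T.A : Set G), conjChar T.θ h hn = T.θ

/-- A character triple `(H, A, θ)` is `N`-linear if `θ` is linear and `ker θ ^ G = N`. -/
def Triple.IsNLinear (T : Triple G) (N : Subgroup G) : Prop :=
  T.IsCharTriple ∧ T.θ 1 = 1 ∧ charKer (indChar T.θ (⊤ : Subgroup G)) = (N : Set G)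

/-- `Irr~(H | θ)`: the irreducible characters `ψ` of `H` above `θ` with `ker ψ ^ G = N`. -/
def IrrTilde (N H : Subgroup G) {A : Subgroup G} (θ : A → ℂ) : Set (H → ℂ) :=
  {ψ | ψ ∈ Irr H ∧ LiesAbove ψ θ ∧ charKer (indChar ψ (⊤ : Subgroup G)) = (N : Set G)}

/-- `Lin~(H | θ)`: the linear characters in `Irr~(H | θ)`. -/
def LinTilde (N H : Subgroup G) {A : Subgroup G} (θ : A → ℂ) : Set (H → ℂ) :=
  {ψ | ψ ∈ IrrTilde N H θ ∧ ψ 1 = 1}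

/-- `L ⧸ K` is abelian (for a normal subgroup `K` of the subgroup `L` of `G`, given as a subset
of `G`): all commutators `[x, y] = x⁻¹ y⁻¹ x y` of elements of `L` lie in `K`. -/
def AbelianModulo (L : Subgroup G) (K : Set G) : Prop :=
  ∀ x ∈ L, ∀ y ∈ L, x⁻¹ * y⁻¹ * x * y ∈ K

/-- `B` is a normal subgroup of `H` containing `ker θ` with `B / ker θ` abelian. -/
def Triple.IsAbelianNormalOverKer (T : Triple G) (B : Subgroup G) : Prop :=
  NormalIn B T.H ∧ charKer T.θ ⊆ (B : Set G) ∧ AbelianModulo B (charKer T.θ)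

/-- `𝒜` is an admissible choice of `𝒜_{(H, A, θ)}`: a normal subgroup of `H` containing `ker θ`,
with `𝒜 / ker θ` abelian, of maximal order among those. -/
def Triple.IsMaxAbelianNormal (T : Triple G) (𝒜 : Subgroup G) : Prop :=
  T.IsAbelianNormalOverKer 𝒜 ∧
    ∀ B : Subgroup G, T.IsAbelianNormalOverKer B → Nat.card B ≤ Nat.card 𝒜

/-- `φ` and `φ'` are in one orbit under the action of `Aut(ℂ | θ) × H`, where `Aut(ℂ | θ)` is the
group of field automorphisms of `ℂ` fixing `ℚ(θ)` elementwise. -/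
def SameOrbit (H : Subgroup G) {A B : Subgroup G} (θ : A → ℂ) (φ φ' : B → ℂ) : Prop :=
  ∃ σ : ℂ ≃+* ℂ, (∀ z ∈ IntermediateField.adjoin ℚ (Set.range θ), σ z = z) ∧
    ∃ h ∈ H, ∃ hn : h ∈ Subgroup.normalizer (B : Set G), φ' = σ ∘ conjChar φ h hn

/-- `R` is a set of representatives of the distinct orbits of `Aut(ℂ | θ) × H` on
`Lin~(𝒜 | θ)`. -/
def Triple.IsOrbitReps (T : Triple G) (N 𝒜 : Subgroup G) (R : Set (𝒜 → ℂ)) : Prop :=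
  R ⊆ LinTilde N 𝒜 T.θ ∧
    ∀ φ' ∈ LinTilde N 𝒜 T.θ, ∃! φ, φ ∈ R ∧ SameOrbit T.H T.θ φ φ'

/-- The set of direct Clifford correspondents of `(H, A, θ)`, for a choice of `𝒜` and of
representatives `R`: the triples `(I_H(φ), 𝒜, φ)` with `φ ∈ R` if `H ≠ A`, and the empty set
if `H = A`. -/
def Triple.Cl (T : Triple G) (𝒜 : Subgroup G) (R : Set (𝒜 → ℂ)) : Set (Triple G) :=
  {T' | T.H ≠ T.A ∧ ∃ φ ∈ R, T' = ⟨inertia T.H φ, 𝒜, φ⟩}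

end NLin

end

open NLin

/-! The engine is Clifford theory over the normal subgroup `𝒜` of `H`, carried out entirely with
class functions. If `φ` is linear on `𝒜` and `ψ` is a character of `I_H(φ)` above `φ`, then
averaging `ψ^H` against `φ` over `𝒜` keeps only the summands of `ψ^H` coming from `I_H(φ)` and
returns `ψ` (`sum_zext_indChar`). This identity makes induction injective, makes it preserve norms
and hence irreducibility (`pair_indChar_indChar`, `indChar_mem_irr`), and shows that Galois
conjugate induced characters come from linear characters in one orbit (`exists_eq_comp_conjChar`).

In the irreducible representation affording a `χ` above `θ`, the group `A` acts by the scalars `θ`,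
so the commutators of `𝒜`, lying in `ker θ`, act trivially. Hence `𝒜` has a common eigenvector, with
eigenvalue character `φ` extending `θ`, and `χ` is induced from `I_H(φ)`. For linear `φ` the kernel
of `φ^G` is the normal core of `ker φ`; this gives `ker φ^G = N` (`exists_mem_linTilde`). Passing to
the representative of the orbit of `φ` costs only a Galois twist, as conjugation in `H` does not
change `χ`.

Part (b) holds because `g ∈ I_H(φ)` means `[g, 𝒜] ≤ ker φ`, a condition on `ker φ` alone. The class
`𝒞` enters only in `A < 𝒜`: the image of `A` in `H / ker θ` is central, so if `H / ker θ` is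
abelian, or has a non-central abelian normal subgroup, then `A` is not maximal. -/

namespace NLin

open Representation

attribute [local instance] Fintype.ofFinite

/-! ### Characters of an abstract finite group: complete reducibility, linear characters,
orthogonality. -/

section Characters

variable {Q : Type*} [Group Q]

/-- The irreducible complex characters of an abstract group. -/
def IsIrrChar (χ : Q → ℂ) : Prop :=
  ∃ (n : ℕ) (ρ : Representation ℂ Q (Fin n → ℂ)), ρ.IsIrreducible ∧ χ = ρ.character

theorem isIrreducible_iff {V : Type*} [AddCommGroup V] [Module ℂ V] (ρ : Representation ℂ Q V) :
    ρ.IsIrreducible ↔ Nontrivial V ∧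
      ∀ W : Submodule ℂ V, (∀ g, ∀ v ∈ W, ρ g v ∈ W) → W = ⊥ ∨ W = ⊤ := by
  constructor
  · intro h
    refine ⟨?_, fun W hW => ?_⟩
    · by_contra hV
      rw [not_nontrivial_iff_subsingleton] at hV
      obtain ⟨a, b, hab⟩ := h.toNontrivial
      exact hab (Subrepresentation.toSubmodule_injective (Subsingleton.elim _ _))
    · rcases h.eq_bot_or_eq_top ⟨W, fun g v hv => hW g v hv⟩ with h | h
      · exact Or.inl (congrArg Subrepresentation.toSubmodule h)
      · exact Or.inr (congrArg Subrepresentation.toSubmodule h)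
  · rintro ⟨hV, h⟩
    refine { exists_pair_ne := ⟨⊥, ⊤, fun e => ?_⟩, eq_bot_or_eq_top := fun W => ?_ }
    · exact bot_ne_top (congrArg Subrepresentation.toSubmodule e : (⊥ : Submodule ℂ V) = ⊤)
    · rcases h W.toSubmodule (fun g v hv => W.apply_mem_toSubmodule g hv) with h | h
      · exact Or.inl (Subrepresentation.toSubmodule_injective h)
      · exact Or.inr (Subrepresentation.toSubmodule_injective h)

/-- Semilinearity lets one statement serve both a change of basis and a twist by a field
automorphism. -/
theorem isIrreducible_of_semilinearEquiv {V W : Type*} [AddCommGroup V] [Module ℂ V]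
    [AddCommGroup W] [Module ℂ W] {τ τ' : ℂ →+* ℂ} [RingHomInvPair τ τ'] [RingHomInvPair τ' τ]
    {ρ : Representation ℂ Q V} {ρ' : Representation ℂ Q W} (e : V ≃ₛₗ[τ] W)
    (he : ∀ g v, e (ρ g v) = ρ' g (e v)) (h : ρ.IsIrreducible) : ρ'.IsIrreducible := by
  rw [isIrreducible_iff] at h ⊢
  obtain ⟨hV, h⟩ := h
  refine ⟨e.symm.toEquiv.nontrivial, fun U hU => ?_⟩
  rcases h (U.comap (e : V →ₛₗ[τ] W)) (fun g v hv => by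
    simp only [Submodule.mem_comap, LinearEquiv.coe_coe] at hv ⊢
    rw [he]; exact hU g _ hv) with h | h
  · left
    rw [eq_bot_iff]
    intro w hw
    have : e.symm w ∈ U.comap (e : V →ₛₗ[τ] W) := by simpa using hw
    rw [h] at this
    simpa using this
  · right
    rw [eq_top_iff]
    intro w _
    have : e.symm w ∈ U.comap (e : V →ₛₗ[τ] W) := by rw [h]; trivial
    simpa using this

theorem isIrrChar_character {V : Type*} [AddCommGroup V] [Module ℂ V] [FiniteDimensional ℂ V]
    (ρ : Representation ℂ Q V) (h : ρ.IsIrreducible) : IsIrrChar ρ.character := by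
  let e := (Module.finBasis ℂ V).equivFun
  let ρ' : Representation ℂ Q (Fin (Module.finrank ℂ V) → ℂ) :=
    { toFun := fun g => e.conj (ρ g)
      map_one' := by rw [map_one, Module.End.one_eq_id, LinearEquiv.conj_id]; rfl
      map_mul' := fun x y => by rw [map_mul, Module.End.mul_eq_comp, LinearEquiv.conj_comp]; rfl }
  refine ⟨_, ρ', isIrreducible_of_semilinearEquiv e (fun g v => ?_) h, ?_⟩
  · simp [ρ', LinearEquiv.conj_apply]
  · funext g
    exact (LinearMap.trace_conj' (ρ g) e).symm

/-- The entrywise action of a field automorphism of `ℂ` on `ℂ ^ n`. -/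
def galoisEquiv (σ : ℂ ≃+* ℂ) (n : ℕ) :
    letI := RingHomInvPair.of_ringEquiv σ
    letI := RingHomInvPair.symm (σ : ℂ →+* ℂ) (σ.symm : ℂ →+* ℂ)
    (Fin n → ℂ) ≃ₛₗ[(σ : ℂ →+* ℂ)] (Fin n → ℂ) :=
  letI := RingHomInvPair.of_ringEquiv σ
  letI := RingHomInvPair.symm (σ : ℂ →+* ℂ) (σ.symm : ℂ →+* ℂ)
  { toFun := fun v i => σ (v i)
    invFun := fun v i => σ.symm (v i)
    map_add' := fun v w => by funext i; simp
    map_smul' := fun c v => by funext i; simp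
    left_inv := fun v => by funext i; simp
    right_inv := fun v => by funext i; simp }

theorem IsIrrChar.galois {χ : Q → ℂ} (h : IsIrrChar χ) (σ : ℂ ≃+* ℂ) : IsIrrChar (σ ∘ χ) := by
  obtain ⟨n, ρ, hρ, rfl⟩ := h
  let _ := RingHomInvPair.of_ringEquiv σ
  let _ := RingHomInvPair.symm (σ : ℂ →+* ℂ) (σ.symm : ℂ →+* ℂ)
  let ρ' : Representation ℂ Q (Fin n → ℂ) :=
    { toFun := fun g => Matrix.toLin' ((LinearMap.toMatrix' (ρ g)).map σ)
      map_one' := by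
        rw [map_one, LinearMap.toMatrix'_one, Matrix.map_one _ (map_zero σ) (map_one σ),
          Matrix.toLin'_one]; rfl
      map_mul' := fun x y => by
        rw [map_mul, LinearMap.toMatrix'_mul, Matrix.map_mul, Matrix.toLin'_mul]; rfl }
  refine ⟨n, ρ', isIrreducible_of_semilinearEquiv (galoisEquiv σ n) (fun g v => ?_) hρ, ?_⟩
  · funext i
    have : ρ g v = (LinearMap.toMatrix' (ρ g)).mulVec v := by
      rw [← Matrix.toLin'_apply, Matrix.toLin'_toMatrix']
    change σ (ρ g v i) = ((LinearMap.toMatrix' (ρ g)).map σ).mulVec (fun i => σ (v i)) i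
    rw [this]
    simp [Matrix.mulVec, dotProduct]
  · funext g
    change σ (LinearMap.trace ℂ _ (ρ g)) = LinearMap.trace ℂ _ (Matrix.toLin' _)
    rw [Matrix.trace_toLin'_eq, LinearMap.trace_eq_matrix_trace ℂ (Pi.basisFun ℂ (Fin n))]
    simp [Matrix.trace, LinearMap.toMatrix', LinearMap.toMatrix]

/-- Induction on the dimension, splitting off an invariant complement by Maschke's theorem. A
multiset records the multiplicities. -/
theorem exists_multiset_irrChar [Finite Q] {V : Type*} [AddCommGroup V] [Module ℂ V]
    [FiniteDimensional ℂ V] (ρ : Representation ℂ Q V) :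
    ∃ s : Multiset (Q → ℂ), (∀ χ ∈ s, IsIrrChar χ) ∧ ρ.character = s.sum := by
  induction hn : Module.finrank ℂ V using Nat.strong_induction_on generalizing V with
  | _ n ih =>
    by_cases hV : Nontrivial V
    swap
    · rw [not_nontrivial_iff_subsingleton] at hV
      refine ⟨0, by simp, ?_⟩
      funext g
      have : ρ g = 0 := LinearMap.ext fun v => Subsingleton.elim _ _
      simp [character, this]
    by_cases hρ : ρ.IsIrreducible
    · exact ⟨{ρ.character}, by simpa using isIrrChar_character ρ hρ, by simp⟩
    have : ∃ W : Subrepresentation ρ, W.toSubmodule ≠ ⊥ ∧ W.toSubmodule ≠ ⊤ := by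
      rw [isIrreducible_iff] at hρ
      push Not at hρ
      obtain ⟨W, h1, h2⟩ := hρ hV
      exact ⟨⟨W, fun g v hv => h1 g v hv⟩, h2⟩
    obtain ⟨W, hb, ht⟩ := this
    have : NeZero (Nat.card Q : ℂ) := ⟨by exact_mod_cast Nat.card_pos.ne'⟩
    obtain ⟨W', hW'⟩ := exists_isCompl W
    have hc : IsCompl W.toSubmodule W'.toSubmodule := by
      rw [isCompl_iff, disjoint_iff, codisjoint_iff] at hW' ⊢
      exact ⟨congrArg Subrepresentation.toSubmodule hW'.1,
        congrArg Subrepresentation.toSubmodule hW'.2⟩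
    have hadd := Submodule.finrank_add_eq_of_isCompl hc
    have h1 : 0 < Module.finrank ℂ W.toSubmodule := by
      rw [Nat.pos_iff_ne_zero]; simpa using hb
    have h2 := Submodule.finrank_lt ht
    obtain ⟨s, hs, es⟩ := ih _ (by omega) W.toRepresentation rfl
    obtain ⟨s', hs', es'⟩ := ih _ (by omega) W'.toRepresentation rfl
    refine ⟨s + s', ?_, ?_⟩
    · intro χ hχ
      rcases Multiset.mem_add.mp hχ with h | h
      exacts [hs _ h, hs' _ h]
    · rw [Multiset.sum_add, ← es, ← es']
      funext g
      have : ρ g = (Submodule.prodEquivOfIsCompl _ _ hc).conj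
          ((W.toRepresentation g).prodMap (W'.toRepresentation g)) := by
        ext v
        obtain ⟨⟨w, w'⟩, rfl⟩ := (Submodule.prodEquivOfIsCompl _ _ hc).surjective v
        simp [LinearEquiv.conj_apply, Subrepresentation.toRepresentation]
      simp only [character, Pi.add_apply]
      rw [this, LinearMap.trace_conj', LinearMap.trace_prodMap']

/-- A linear character of an abstract group. -/
def IsLin (φ : Q → ℂ) : Prop := φ 1 = 1 ∧ ∀ x y, φ (x * y) = φ x * φ y

theorem end_fin_one (f : Module.End ℂ (Fin 1 → ℂ)) : f = LinearMap.trace ℂ _ f • LinearMap.id := by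
  have h : LinearMap.trace ℂ _ f = f (Pi.single 0 1) 0 := by
    rw [LinearMap.trace_eq_matrix_trace ℂ (Pi.basisFun ℂ (Fin 1))]
    simp [Matrix.trace]
  rw [h]
  ext i j
  fin_cases i; fin_cases j
  simp

theorem IsIrrChar.isLin {φ : Q → ℂ} (h : IsIrrChar φ) (h1 : φ 1 = 1) : IsLin φ := by
  obtain ⟨n, ρ, hρ, rfl⟩ := h
  have hn : n = 1 := by simpa using h1
  subst hn
  refine ⟨h1, fun x y => ?_⟩
  have : ρ (x * y) = (ρ.character x * ρ.character y) • LinearMap.id := by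
    rw [map_mul, end_fin_one (ρ x), end_fin_one (ρ y)]
    ext
    simp only [character]
    simp
    ring
  conv_lhs => rw [character, this]
  simp

theorem IsLin.isIrrChar {φ : Q → ℂ} (h : IsLin φ) : IsIrrChar φ := by
  let ρ : Representation ℂ Q (Fin 1 → ℂ) :=
    { toFun := fun g => φ g • LinearMap.id
      map_one' := by rw [h.1, one_smul]; rfl
      map_mul' := fun x y => by ext; simp [h.2]; ring }
  refine ⟨1, ρ, ?_, ?_⟩
  · rw [isIrreducible_iff]
    refine ⟨inferInstance, fun W _ => ?_⟩
    have : IsSimpleOrder (Submodule ℂ (Fin 1 → ℂ)) := by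
      rw [← isSimpleModule_iff, isSimpleModule_iff_finrank_eq_one]; simp
    exact eq_bot_or_eq_top W
  · funext g
    simp [ρ, character]

theorem IsLin.map_inv {φ : Q → ℂ} (h : IsLin φ) (x : Q) : φ x⁻¹ = (φ x)⁻¹ := by
  have : φ x * φ x⁻¹ = 1 := by rw [← h.2, mul_inv_cancel, h.1]
  exact (inv_eq_of_mul_eq_one_right this).symm

theorem IsLin.ne_zero {φ : Q → ℂ} (h : IsLin φ) (x : Q) : φ x ≠ 0 := fun h0 => by
  have : φ x * φ x⁻¹ = 1 := by rw [← h.2, mul_inv_cancel, h.1]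
  simp [h0] at this

theorem IsLin.norm [Finite Q] {φ : Q → ℂ} (h : IsLin φ) (x : Q) : ‖φ x‖ = 1 := by
  have hp : ∀ n : ℕ, φ (x ^ n) = φ x ^ n := fun n => by
    induction n with
    | zero => simp [h.1]
    | succ n ih => rw [pow_succ, h.2, ih, pow_succ]
  refine Complex.norm_eq_one_of_pow_eq_one (n := orderOf x) ?_ (orderOf_pos x).ne'
  rw [← hp, pow_orderOf_eq_one, h.1]

theorem IsLin.star [Finite Q] {φ : Q → ℂ} (h : IsLin φ) (x : Q) :
    starRingEnd ℂ (φ x) = φ x⁻¹ := by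
  rw [h.map_inv, Complex.inv_eq_conj (h.norm x)]

theorem IsIrrChar.isLin_of_comm [Finite Q] [IsMulCommutative Q] {φ : Q → ℂ} (h : IsIrrChar φ) :
    IsLin φ := by
  refine h.isLin ?_
  obtain ⟨n, ρ, hρ, rfl⟩ := h
  rw [char_one, IsIrreducible.finrank_eq_one_of_isMulCommutative ρ, Nat.cast_one]

omit [Group Q] in
theorem multiset_sum_apply (s : Multiset (Q → ℂ)) (x : Q) :
    s.sum x = (s.map fun χ => χ x).sum :=
  map_multiset_sum (Pi.evalAddMonoidHom (fun _ : Q => ℂ) x) s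

/-- Restricted to the cyclic group generated by `g`, the character is a sum of linear characters,
whose values have norm one. -/
theorem star_character [Finite Q] {V : Type*} [AddCommGroup V] [Module ℂ V]
    [FiniteDimensional ℂ V] (ρ : Representation ℂ Q V) (g : Q) :
    starRingEnd ℂ (ρ.character g) = ρ.character g⁻¹ := by
  obtain ⟨s, hs, e⟩ := exists_multiset_irrChar (ρ.comp (Subgroup.zpowers g).subtype)
  let γ : Subgroup.zpowers g := ⟨g, Subgroup.mem_zpowers g⟩
  have h1 : ρ.character g = (s.map fun χ => χ γ).sum := by
    rw [← multiset_sum_apply, ← e]; rfl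
  have h2 : ρ.character g⁻¹ = (s.map fun χ => χ γ⁻¹).sum := by
    rw [← multiset_sum_apply, ← e]; rfl
  rw [h1, h2, map_multiset_sum, Multiset.map_map]
  congr 1
  refine Multiset.map_congr rfl fun χ hχ => ?_
  exact (hs χ hχ).isLin_of_comm.star γ

/-- The bilinear pairing `|Q|⁻¹ ∑ f x * f' x⁻¹`, which is the hermitian product on characters. -/
noncomputable def pair [Finite Q] (f f' : Q → ℂ) : ℂ :=
  (Nat.card Q : ℂ)⁻¹ * ∑ x, f x * f' x⁻¹

variable [Finite Q]

theorem natCast_card_ne_zero : (Nat.card Q : ℂ) ≠ 0 := by exact_mod_cast Nat.card_pos.ne'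

theorem pair_comm (f f' : Q → ℂ) : pair f f' = pair f' f := by
  unfold pair
  congr 1
  rw [← Equiv.sum_comp (Equiv.inv Q)]
  simp [mul_comm]

theorem pair_add_left (f f' h : Q → ℂ) : pair (f + f') h = pair f h + pair f' h := by
  simp [pair, add_mul, Finset.sum_add_distrib, mul_add]

theorem pair_multiset_sum_left (s : Multiset (Q → ℂ)) (h : Q → ℂ) :
    pair s.sum h = (s.map fun f => pair f h).sum := by
  induction s using Multiset.induction_on with
  | empty => simp [pair]
  | cons a s ih => simp [pair_add_left, ih]

theorem pair_sub_self (f f' : Q → ℂ) :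
    pair (f - f') (f - f') = pair f f - 2 * pair f f' + pair f' f' := by
  have : pair (f - f') (f - f') = pair f f - pair f f' - pair f' f + pair f' f' := by
    simp only [pair, ← mul_sub, ← mul_add, ← Finset.sum_sub_distrib, ← Finset.sum_add_distrib,
      Pi.sub_apply]
    congr 1
    exact Finset.sum_congr rfl fun x _ => by ring
  rw [this, pair_comm f' f]; ring

theorem pair_irrChar {χ χ' : Q → ℂ} (h : IsIrrChar χ) (h' : IsIrrChar χ') :
    (χ = χ' → pair χ χ' = 1) ∧ (χ ≠ χ' → pair χ χ' = 0) := by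
  obtain ⟨n, ρ, hρ, rfl⟩ := h
  obtain ⟨n', ρ', hρ', rfl⟩ := h'
  let _ : Invertible (Nat.card Q : ℂ) := invertibleOfNonzero natCast_card_ne_zero
  constructor
  · intro e
    rw [← e]
    unfold pair
    rw [char_orthonormal ρ ρ, if_pos ⟨Representation.Equiv.refl ρ⟩]
  · intro e
    unfold pair
    rw [char_orthonormal ρ ρ', if_neg]
    rintro ⟨i⟩
    exact e (char_iso i).symm

theorem exists_nat_pair_sum {s : Multiset (Q → ℂ)} (hs : ∀ χ ∈ s, IsIrrChar χ) {ψ : Q → ℂ}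
    (hψ : IsIrrChar ψ) : ∃ m : ℕ, pair s.sum ψ = m := by
  induction s using Multiset.induction_on with
  | empty => exact ⟨0, by simp [pair]⟩
  | cons a s ih =>
    obtain ⟨m, hm⟩ := ih fun χ h => hs χ (Multiset.mem_cons_of_mem h)
    have ha := pair_irrChar (hs a (Multiset.mem_cons_self a s)) hψ
    by_cases h : a = ψ
    · exact ⟨1 + m, by simp [pair_add_left, hm, ha.1 h]⟩
    · exact ⟨m, by simp [pair_add_left, hm, ha.2 h]⟩

theorem exists_nat_pair {V : Type*} [AddCommGroup V] [Module ℂ V] [FiniteDimensional ℂ V]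
    (ρ : Representation ℂ Q V) {ψ : Q → ℂ} (hψ : IsIrrChar ψ) :
    ∃ m : ℕ, pair ρ.character ψ = m := by
  obtain ⟨s, hs, e⟩ := exists_multiset_irrChar ρ
  rw [e]
  exact exists_nat_pair_sum hs hψ

/-- Multiplicities are natural numbers, so the contribution of `ψ` cannot be cancelled. -/
theorem pair_ne_zero_of_mem {s : Multiset (Q → ℂ)} (hs : ∀ χ ∈ s, IsIrrChar χ) {ψ : Q → ℂ}
    (hψ : ψ ∈ s) : pair s.sum ψ ≠ 0 := by
  obtain ⟨t, rfl⟩ := Multiset.exists_cons_of_mem hψ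
  obtain ⟨m, hm⟩ := exists_nat_pair_sum (fun χ h => hs χ (Multiset.mem_cons_of_mem h)) (hs ψ hψ)
  rw [Multiset.sum_cons, pair_add_left, hm, (pair_irrChar (hs ψ hψ) (hs ψ hψ)).1 rfl]
  exact_mod_cast (Nat.succ_ne_zero m) ∘ fun h => by omega

/-- The left regular representation on functions. -/
def regularRep (Q : Type*) [Group Q] : Representation ℂ Q (Q → ℂ) where
  toFun g := LinearMap.funLeft ℂ ℂ fun x => g⁻¹ * x
  map_one' := by ext; simp [LinearMap.funLeft]
  map_mul' x y := by ext; simp [LinearMap.funLeft, mul_assoc]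

open Classical in
theorem character_regularRep (g : Q) :
    (regularRep Q).character g = if g = 1 then (Nat.card Q : ℂ) else 0 := by
  rw [character, LinearMap.trace_eq_matrix_trace ℂ (Pi.basisFun ℂ Q), Matrix.trace]
  simp only [Matrix.diag, LinearMap.toMatrix_apply]
  simp [regularRep, LinearMap.funLeft, Pi.single_apply]

/-- The regular character pairs with `f` to `f 1`, so one of its irreducible constituents pairs
non-trivially with `f`. -/
theorem exists_irrChar_pair_ne_zero {f : Q → ℂ} (hf : f 1 ≠ 0) :
    ∃ χ, IsIrrChar χ ∧ pair χ f ≠ 0 := by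
  by_contra! hc
  obtain ⟨s, hs, e⟩ := exists_multiset_irrChar (regularRep Q)
  have h0 : pair (regularRep Q).character f = 0 := by
    rw [e, pair_multiset_sum_left]
    exact Multiset.sum_eq_zero fun x hx => by
      obtain ⟨χ, hχ, rfl⟩ := Multiset.mem_map.mp hx
      exact hc χ (hs χ hχ)
  apply hf
  rw [← h0]
  unfold pair
  simp only [character_regularRep]
  rw [Finset.sum_eq_single 1 (fun b _ hb => by simp [hb]) (by simp)]
  simp

theorem pair_self_eq_norm {f : Q → ℂ} (hf : ∀ x, starRingEnd ℂ (f x) = f x⁻¹) :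
    pair f f = (((Nat.card Q : ℝ)⁻¹ * ∑ x, ‖f x‖ ^ 2 : ℝ) : ℂ) := by
  unfold pair
  push_cast
  congr 1
  refine Finset.sum_congr rfl fun x _ => ?_
  rw [← hf, Complex.mul_conj, Complex.normSq_eq_norm_sq]
  push_cast
  rfl

theorem eq_zero_of_pair_self {f : Q → ℂ} (hf : ∀ x, starRingEnd ℂ (f x) = f x⁻¹)
    (h : pair f f = 0) : f = 0 := by
  rw [pair_self_eq_norm hf] at h
  have h' := Complex.ofReal_eq_zero.mp h
  have hc : (Nat.card Q : ℝ)⁻¹ ≠ 0 := inv_ne_zero (by exact_mod_cast Nat.card_pos.ne')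
  have h2 := (mul_eq_zero.mp h').resolve_left hc
  rw [Finset.sum_eq_zero_iff_of_nonneg fun x _ => by positivity] at h2
  funext x
  simpa using h2 x (Finset.mem_univ x)

/-- A function of norm one with an integral non-zero multiplicity in an irreducible character
is that character. -/
theorem eq_of_pair_eq_natCast {f χ : Q → ℂ} (hf : ∀ x, starRingEnd ℂ (f x) = f x⁻¹)
    (h1 : pair f f = 1) (hχ : IsIrrChar χ) {m : ℕ} (hm : pair χ f = m) (h0 : m ≠ 0) : χ = f := by
  have hd : ∀ x, starRingEnd ℂ ((χ - f) x) = (χ - f) x⁻¹ := fun x => by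
    obtain ⟨n, ρ, -, rfl⟩ := hχ
    simp [hf, star_character]
  have h2 := pair_sub_self χ f
  rw [h1, hm, (pair_irrChar hχ hχ).1 rfl] at h2
  have h3 := h2
  rw [pair_self_eq_norm hd] at h3
  have h4 : ((Nat.card Q : ℝ)⁻¹ * ∑ x, ‖(χ - f) x‖ ^ 2 : ℝ) = 1 - 2 * m + 1 := by
    exact_mod_cast h3
  -- The squared norm of `χ - f` is `2 - 2m`; being non-negative it forces `m = 1`, and then it
  -- vanishes.
  have h5 : (0 : ℝ) ≤ 1 - 2 * m + 1 := by rw [← h4]; positivity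
  have h6 : m = 1 := by
    have : (m : ℝ) ≤ 1 := by linarith
    have : m ≤ 1 := by exact_mod_cast this
    omega
  rw [h6] at h2
  exact sub_eq_zero.mp (eq_zero_of_pair_self hd (by rw [h2]; norm_num))

end Characters

/-! ### Induced class functions, Frobenius reciprocity, and recovery of `ψ` from `ψ^H`. -/

section Induction

variable {G : Type*} [Group G]

open Classical in
/-- Extension of a function on a subgroup by zero. -/
noncomputable def zext {K : Subgroup G} (ψ : K → ℂ) (g : G) : ℂ :=
  if h : g ∈ K then ψ ⟨g, h⟩ else 0

theorem zext_of_mem {K : Subgroup G} (ψ : K → ℂ) {g : G} (h : g ∈ K) : zext ψ g = ψ ⟨g, h⟩ :=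
  dif_pos h

theorem zext_of_notMem {K : Subgroup G} (ψ : K → ℂ) {g : G} (h : g ∉ K) : zext ψ g = 0 :=
  dif_neg h

@[simp] theorem zext_coe {K : Subgroup G} (ψ : K → ℂ) (g : K) : zext ψ g = ψ g :=
  zext_of_mem ψ g.2

/-- Class functions on a subgroup. -/
def IsClassFun {K : Subgroup G} (ψ : K → ℂ) : Prop := ∀ x g, ψ (x * g * x⁻¹) = ψ g

theorem conj_mem_iff {K : Subgroup G} {x g : G} (hx : x ∈ K) : x * g * x⁻¹ ∈ K ↔ g ∈ K := by
  rw [K.mul_mem_cancel_right (K.inv_mem hx), K.mul_mem_cancel_left hx]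

theorem IsClassFun.zext_conj {K : Subgroup G} {ψ : K → ℂ} (h : IsClassFun ψ) {x : G}
    (hx : x ∈ K) (g : G) : zext ψ (x * g * x⁻¹) = zext ψ g := by
  by_cases hg : g ∈ K
  · rw [zext_of_mem _ hg, zext_of_mem _ ((conj_mem_iff hx).mpr hg)]
    exact h ⟨x, hx⟩ ⟨g, hg⟩
  · rw [zext_of_notMem _ hg, zext_of_notMem _ (fun h => hg ((conj_mem_iff hx).mp h))]

theorem isClassFun_of_mem_irr {K : Subgroup G} {ψ : K → ℂ} (h : ψ ∈ Irr K) : IsClassFun ψ := by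
  obtain ⟨n, ρ, -, rfl⟩ := h
  intro x g
  simp

variable [Finite G]

theorem indChar_apply {K L : Subgroup G} (ψ : K → ℂ) (g : L) :
    indChar ψ L g = (Nat.card K : ℂ)⁻¹ * ∑ x : L, zext ψ ((x : G) * g * (x : G)⁻¹) := by
  unfold indChar
  rw [finsum_eq_sum_of_fintype]
  rfl

/-- Extending by zero makes the induction formula valid on all of `G`: for `y` outside `H`, no
`H`-conjugate of `y` meets `K`. -/
theorem zext_indChar {K H : Subgroup G} (hKH : K ≤ H) (ψ : K → ℂ) (y : G) :
    zext (indChar ψ H) y = (Nat.card K : ℂ)⁻¹ * ∑ x : H, zext ψ ((x : G) * y * (x : G)⁻¹) := by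
  by_cases hy : y ∈ H
  · rw [zext_of_mem _ hy, indChar_apply]
  · rw [zext_of_notMem _ hy, Finset.sum_eq_zero, mul_zero]
    intro x _
    exact zext_of_notMem _ fun h => hy ((conj_mem_iff x.2).mp (hKH h))

theorem isClassFun_indChar {K H : Subgroup G} (ψ : K → ℂ) : IsClassFun (indChar ψ H) := by
  intro x g
  rw [indChar_apply, indChar_apply]
  congr 1
  rw [← Equiv.sum_comp (Equiv.mulRight x) fun z : H => zext ψ ((z : G) * g * (z : G)⁻¹)]
  refine Finset.sum_congr rfl fun z _ => ?_
  congr 1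
  simp [mul_assoc]

theorem indChar_indChar {K H L : Subgroup G} (hKH : K ≤ H) (hHL : H ≤ L) (ψ : K → ℂ) :
    indChar (indChar ψ H) L = indChar ψ L := by
  funext g
  rw [indChar_apply, indChar_apply]
  simp only [zext_indChar hKH]
  rw [← Finset.mul_sum, Finset.sum_comm]
  have : ∀ y : H, ∑ x : L, zext ψ ((y : G) * ((x : G) * g * (x : G)⁻¹) * (y : G)⁻¹) =
      ∑ x : L, zext ψ ((x : G) * g * (x : G)⁻¹) := fun y => by
    rw [← Equiv.sum_comp (Equiv.mulLeft (⟨y, hHL y.2⟩ : L))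
      fun x : L => zext ψ ((x : G) * g * (x : G)⁻¹)]
    refine Finset.sum_congr rfl fun z _ => ?_
    congr 1
    simp [mul_assoc]
  simp only [this]
  rw [Finset.sum_const, Finset.card_univ, Fintype.card_eq_nat_card, nsmul_eq_mul, ← mul_assoc,
    ← mul_assoc, mul_comm _ (Nat.card H : ℂ), ← mul_assoc, mul_inv_cancel₀ natCast_card_ne_zero,
    one_mul]

theorem star_indChar {K H : Subgroup G} {ψ : K → ℂ}
    (h : ∀ x, starRingEnd ℂ (ψ x) = ψ x⁻¹) (g : H) :
    starRingEnd ℂ (indChar ψ H g) = indChar ψ H g⁻¹ := by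
  rw [indChar_apply, indChar_apply, map_mul, map_sum, map_inv₀, Complex.conj_natCast]
  congr 1
  refine Finset.sum_congr rfl fun x _ => ?_
  have e : (x : G) * ((g⁻¹ : H) : G) * (x : G)⁻¹ = ((x : G) * g * (x : G)⁻¹)⁻¹ := by
    simp [mul_assoc]
  rw [e]
  by_cases hx : (x : G) * g * (x : G)⁻¹ ∈ K
  · rw [zext_of_mem _ hx, zext_of_mem _ (K.inv_mem hx), h]; rfl
  · rw [zext_of_notMem _ hx, zext_of_notMem _ (fun h => hx (K.inv_mem_iff.mp h)), map_zero]

theorem sum_eq_sum_subgroup {K H : Subgroup G} (hKH : K ≤ H) (F : G → ℂ)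
    (hF : ∀ g ∉ K, F g = 0) : ∑ g : H, F g = ∑ k : K, F k := by
  symm
  refine Fintype.sum_of_injective (Subgroup.inclusion hKH) (Subgroup.inclusion_injective hKH) _ _
    (fun g hg => hF g fun hgK => hg ⟨⟨g, hgK⟩, rfl⟩) fun k => rfl

/-- Frobenius reciprocity. As `χ` is a class function, every `x ∈ H` contributes the same sum, and
the `|H|` copies cancel the normalising factor. -/
theorem pair_indChar {K H : Subgroup G} (hKH : K ≤ H) (ψ : K → ℂ) {χ : H → ℂ}
    (hχ : IsClassFun χ) :
    pair (indChar ψ H) χ = pair ψ (χ ∘ Subgroup.inclusion hKH) := by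
  have h1 : ∀ x : H, ∑ g : H, zext ψ ((x : G) * g * (x : G)⁻¹) * χ g⁻¹ =
      ∑ k : K, ψ k * χ (Subgroup.inclusion hKH k⁻¹) := fun x => by
    have e1 : ∑ g : H, zext ψ ((x : G) * g * (x : G)⁻¹) * χ g⁻¹ =
        ∑ g : H, zext ψ (g : G) * zext χ (g : G)⁻¹ := by
      rw [← Equiv.sum_comp (MulAut.conj x).toEquiv fun g : H => zext ψ (g : G) * zext χ (g : G)⁻¹]
      refine Finset.sum_congr rfl fun g _ => ?_
      have e2 : (x : G) * (g : G) * (x : G)⁻¹ = ((x * g * x⁻¹ : H) : G) := by simp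
      simp only [MulEquiv.toEquiv_eq_coe, EquivLike.coe_coe, MulAut.conj_apply, e2]
      rw [← Subgroup.coe_inv, zext_coe]
      have e3 : (x * g * x⁻¹)⁻¹ = x * g⁻¹ * x⁻¹ := by group
      rw [e3, hχ]
    rw [e1, sum_eq_sum_subgroup hKH (fun g => zext ψ g * zext χ g⁻¹)
      fun g hg => by rw [zext_of_notMem _ hg, zero_mul]]
    refine Finset.sum_congr rfl fun k _ => ?_
    rw [zext_coe]
    congr 1
    exact zext_coe χ (Subgroup.inclusion hKH k⁻¹)
  unfold pair
  simp only [indChar_apply, mul_assoc, Finset.sum_mul]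
  rw [← Finset.mul_sum, Finset.sum_comm]
  simp only [mul_assoc] at h1
  simp only [h1]
  rw [Finset.sum_const, Finset.card_univ, Fintype.card_eq_nat_card, nsmul_eq_mul, mul_left_comm,
    ← mul_assoc (Nat.card H : ℂ)⁻¹, inv_mul_cancel₀ natCast_card_ne_zero, one_mul]
  rfl

theorem indChar_comp_ringEquiv {K L : Subgroup G} (σ : ℂ ≃+* ℂ) (ψ : K → ℂ) :
    indChar (σ ∘ ψ) L = σ ∘ indChar ψ L := by
  funext g
  simp only [Function.comp, indChar_apply, map_mul, map_inv₀, map_natCast, map_sum]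
  congr 1
  refine Finset.sum_congr rfl fun x _ => ?_
  by_cases hx : (x : G) * g * (x : G)⁻¹ ∈ K
  · rw [zext_of_mem _ hx, zext_of_mem _ hx]; rfl
  · rw [zext_of_notMem _ hx, zext_of_notMem _ hx, map_zero]

omit [Finite G] in
theorem charKer_comp_ringEquiv {K : Subgroup G} (σ : ℂ ≃+* ℂ) (ψ : K → ℂ) :
    charKer (σ ∘ ψ) = charKer ψ := by
  simp [charKer]

/-- Passes from the hermitian product to the bilinear `pair`, which commutes with field
automorphisms. -/
theorem charInner_of_isLin {K A : Subgroup G} (hA : A ≤ K) (χ : K → ℂ) {θ : A → ℂ}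
    (hθ : IsLin θ) :
    charInner (χ ∘ Subgroup.inclusion hA) θ = pair (χ ∘ Subgroup.inclusion hA) θ := by
  unfold charInner pair
  rw [finsum_eq_sum_of_fintype]
  simp only [hθ.star]

theorem liesAbove_iff {K A : Subgroup G} (hA : A ≤ K) (χ : K → ℂ) {θ : A → ℂ} (hθ : IsLin θ) :
    LiesAbove χ θ ↔ pair (χ ∘ Subgroup.inclusion hA) θ ≠ 0 := by
  rw [← charInner_of_isLin hA χ hθ]
  exact ⟨fun ⟨_, h⟩ => h, fun h => ⟨hA, h⟩⟩

/-- `ψ`, extended by zero, transforms under left translation by `A` according to `φ`. -/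
def IsOver {A K : Subgroup G} (φ : A → ℂ) (ψ : K → ℂ) : Prop :=
  ∀ (a : A) (g : G), zext ψ (a * g) = φ a * zext ψ g

omit [Finite G] in
theorem inertia_le {B : Subgroup G} (H : Subgroup G) (φ : B → ℂ) : inertia H φ ≤ H :=
  fun _ h => h.1

omit [Finite G] in
theorem isLin_conjChar {B : Subgroup G} {φ : B → ℂ} (h : IsLin φ) {x : G}
    (hx : x ∈ Subgroup.normalizer (B : Set G)) : IsLin (conjChar φ x hx) := by
  refine ⟨?_, fun a b => ?_⟩
  · rw [← h.1]
    unfold conjChar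
    congr 1
    ext
    simp
  · unfold conjChar
    rw [← h.2]
    congr 1
    ext
    simp [mul_assoc]

omit [Finite G] in
theorem zext_conj_eq {B : Subgroup G} (φ : B → ℂ) {x : G}
    (hx : x ∈ Subgroup.normalizer (B : Set G)) (b : B) :
    zext φ (x * b * x⁻¹) = conjChar φ x hx b :=
  zext_of_mem _ _

omit [Finite G] in
theorem IsLin.le_inertia {B H : Subgroup G} {φ : B → ℂ} (h : IsLin φ) (hB : B ≤ H) :
    B ≤ inertia H φ := fun b hb => by
  refine ⟨hB hb, Subgroup.le_normalizer hb, ?_⟩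
  funext a
  change φ (⟨b, hb⟩ * a * ⟨b, hb⟩⁻¹) = φ a
  rw [h.2, h.2, h.map_inv, mul_right_comm, mul_inv_cancel₀ (h.ne_zero _), one_mul]

variable {H B : Subgroup G} {φ : B → ℂ}

omit [Finite G] in
theorem IsOver.zext_one_eq {K : Subgroup G} {ψ : K → ℂ} (hψ : IsOver φ ψ) (b : B) :
    zext ψ b = φ b * ψ 1 := by
  have := hψ b 1
  rw [mul_one] at this
  rw [this]
  congr 1
  exact zext_coe ψ 1

theorem sum_isLin_inv_mul {Q : Type*} [Group Q] [Finite Q] {φ φ' : Q → ℂ} (h : IsLin φ)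
    (h' : IsLin φ') :
    (φ' = φ → ∑ b, φ b⁻¹ * φ' b = Nat.card Q) ∧ (φ' ≠ φ → ∑ b, φ b⁻¹ * φ' b = 0) := by
  have key := pair_irrChar h'.isIrrChar h.isIrrChar
  have e : ∑ b, φ b⁻¹ * φ' b = Nat.card Q * pair φ' φ := by
    unfold pair
    rw [← mul_assoc, mul_inv_cancel₀ natCast_card_ne_zero, one_mul]
    exact Finset.sum_congr rfl fun b _ => mul_comm _ _
  rw [e]
  exact ⟨fun hh => by rw [key.1 hh, mul_one], fun hh => by rw [key.2 hh, mul_zero]⟩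

/-- The summand of `ψ^H` at `x` transforms under `B` by `φ^x`. Orthogonality kills it unless `φ^x =
φ`, that is `x ∈ I_H(φ)`; each of the remaining `x` contributes the same value, because `ψ` is a
class function. -/
theorem sum_zext_indChar (hB : ∀ x ∈ H, x ∈ Subgroup.normalizer (B : Set G)) (hφ : IsLin φ)
    {ψ : inertia H φ → ℂ} (hc : IsClassFun ψ) (hψ : IsOver φ ψ) (g : G) :
    ∑ b : B, φ b⁻¹ * zext (indChar ψ H) (b * g) = Nat.card B * zext ψ g := by
  simp only [zext_indChar (inertia_le H φ), Finset.mul_sum]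
  rw [Finset.sum_comm]
  have h1 : ∀ x : H, ∑ b : B, φ b⁻¹ * ((Nat.card (inertia H φ) : ℂ)⁻¹ *
      zext ψ ((x : G) * (b * g) * (x : G)⁻¹)) =
      zext (fun _ : inertia H φ => (Nat.card (inertia H φ) : ℂ)⁻¹ * (Nat.card B * zext ψ g)) x :=
      fun x => by
    have h2 : ∀ b : B, zext ψ ((x : G) * (b * g) * (x : G)⁻¹) =
        conjChar φ x (hB x x.2) b * zext ψ ((x : G) * g * (x : G)⁻¹) := fun b => by
      rw [← zext_conj_eq φ (hB x x.2) b,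
        zext_of_mem φ ((Subgroup.mem_normalizer_iff.mp (hB x x.2) b).mp b.2), ← hψ]
      congr 1
      simp [mul_assoc]
    simp only [h2]
    have h3 : ∀ b : B, φ b⁻¹ * ((Nat.card (inertia H φ) : ℂ)⁻¹ *
        (conjChar φ x (hB x x.2) b * zext ψ ((x : G) * g * (x : G)⁻¹))) =
        (φ b⁻¹ * conjChar φ x (hB x x.2) b) * ((Nat.card (inertia H φ) : ℂ)⁻¹ *
          zext ψ ((x : G) * g * (x : G)⁻¹)) := fun b => by ring
    simp only [h3]
    rw [← Finset.sum_mul]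
    have key := sum_isLin_inv_mul hφ (isLin_conjChar hφ (hB x x.2))
    by_cases hx : (x : G) ∈ inertia H φ
    · have hx' := hx
      obtain ⟨_, _, e⟩ := hx
      rw [key.1 e, zext_of_mem _ hx', hc.zext_conj hx']
      ring
    · rw [key.2 fun e => hx ⟨x.2, hB x x.2, e⟩, zext_of_notMem _ hx, zero_mul]
  simp only [h1]
  rw [sum_eq_sum_subgroup (inertia_le H φ) (zext _) fun x hx => zext_of_notMem _ hx]
  simp only [zext_coe]
  rw [Finset.sum_const, Finset.card_univ, Fintype.card_eq_nat_card, nsmul_eq_mul, ← mul_assoc,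
    mul_inv_cancel₀ natCast_card_ne_zero, one_mul]

theorem indChar_injective (hB : ∀ x ∈ H, x ∈ Subgroup.normalizer (B : Set G)) (hφ : IsLin φ)
    {ψ ψ' : inertia H φ → ℂ} (hc : IsClassFun ψ) (hψ : IsOver φ ψ) (hc' : IsClassFun ψ')
    (hψ' : IsOver φ ψ') (e : indChar ψ H = indChar ψ' H) : ψ = ψ' := by
  funext g
  have h := sum_zext_indChar hB hφ hc hψ g
  rw [e, sum_zext_indChar hB hφ hc' hψ' g] at h
  simpa using (mul_left_cancel₀ natCast_card_ne_zero h).symm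

theorem pair_indChar_indChar (hB : ∀ x ∈ H, x ∈ Subgroup.normalizer (B : Set G)) (hBH : B ≤ H)
    (hφ : IsLin φ) {ψ ψ' : inertia H φ → ℂ} (hc : IsClassFun ψ) (hψ : IsOver φ ψ)
    (hc' : IsClassFun ψ') (hψ' : IsOver φ ψ') :
    pair (indChar ψ H) (indChar ψ' H) = pair ψ ψ' := by
  rw [pair_indChar (inertia_le H φ) _ (isClassFun_indChar ψ'), pair_comm, pair_comm ψ]
  have hBI : B ≤ inertia H φ := hφ.le_inertia hBH
  unfold pair
  congr 1
  -- The factor `|B|` becomes a sum over `b`; translating `x` by `b` in the `b`-th copy produces the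
  -- average of `sum_zext_indChar`.
  apply mul_left_cancel₀ (natCast_card_ne_zero (Q := B))
  have h1 : ∀ b : B, ∑ x : inertia H φ, (indChar ψ' H ∘ Subgroup.inclusion (inertia_le H φ)) x *
      ψ x⁻¹ = ∑ x : inertia H φ, (φ b⁻¹ * zext (indChar ψ' H) (b * x)) * ψ x⁻¹ := fun b => by
    rw [← Equiv.sum_comp (Equiv.mulLeft (⟨b, hBI b.2⟩ : inertia H φ))]
    refine Finset.sum_congr rfl fun x _ => ?_
    have e1 : zext (indChar ψ' H) (b * x) = (indChar ψ' H ∘ Subgroup.inclusion (inertia_le H φ))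
        (Equiv.mulLeft (⟨b, hBI b.2⟩ : inertia H φ) x) := zext_of_mem _ _
    have e2 : ψ (Equiv.mulLeft (⟨b, hBI b.2⟩ : inertia H φ) x)⁻¹ = φ b⁻¹ * ψ x⁻¹ := by
      have := hψ b⁻¹ (x : G)⁻¹
      rw [← Subgroup.coe_inv, zext_coe] at this
      rw [← this, ← hc ⟨b, hBI b.2⟩⁻¹]
      symm
      refine (zext_of_mem _ ?_).trans ?_
      · exact (inertia H φ).mul_mem (hBI (B.inv_mem b.2)) (SetLike.coe_mem _)
      · congr 1
        ext
        simp [mul_assoc]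
    rw [e1, e2]
    ring
  have h2 := Finset.sum_congr (rfl : (Finset.univ : Finset B) = _) fun b _ => h1 b
  rw [Finset.sum_const, Finset.card_univ, Fintype.card_eq_nat_card, nsmul_eq_mul,
    Finset.sum_comm] at h2
  rw [h2, Finset.mul_sum]
  refine Finset.sum_congr rfl fun x _ => ?_
  rw [← Finset.sum_mul, sum_zext_indChar hB hφ hc' hψ' x, zext_coe, mul_assoc]

theorem zext_indChar_eq_sum (hB : ∀ x ∈ H, x ∈ Subgroup.normalizer (B : Set G))
    {ψ : inertia H φ → ℂ} (hψ : IsOver φ ψ) (b : B) :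
    zext (indChar ψ H) b =
      (Nat.card (inertia H φ) : ℂ)⁻¹ * ∑ x : H, conjChar φ x (hB x x.2) b * ψ 1 := by
  rw [zext_indChar (inertia_le H φ)]
  congr 1
  refine Finset.sum_congr rfl fun x _ => ?_
  exact hψ.zext_one_eq ⟨(x : G) * b * (x : G)⁻¹, _⟩

end Induction

/-! ### Weight spaces of linear characters. -/

section Weight

variable {Q B V : Type*} [Group Q] [Group B] [AddCommGroup V] [Module ℂ V]

/-- The vectors on which `B` acts, through `ι`, by the scalars `φ`. -/
def weightSpace (ρ : Representation ℂ Q V) (ι : B →* Q) (φ : B → ℂ) : Submodule ℂ V where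
  carrier := {v | ∀ b, ρ (ι b) v = φ b • v}
  add_mem' := fun {v w} hv hw b => by rw [map_add, hv b, hw b, smul_add]
  zero_mem' := fun b => by simp
  smul_mem' := fun c v hv b => by rw [map_smul, hv b, smul_comm]

/-- After twisting by the inverse of `φ`, the weight space is the space of invariants, whose
dimension is the average of the character. -/
theorem pair_eq_finrank_weightSpace [Finite B] [FiniteDimensional ℂ V] (ρ : Representation ℂ Q V)
    (ι : B →* Q) {φ : B → ℂ} (hφ : IsLin φ) :
    pair (ρ.character ∘ ι) φ = Module.finrank ℂ (weightSpace ρ ι φ) := by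
  let τ : Representation ℂ B V :=
    { toFun := fun b => φ b⁻¹ • ρ (ι b)
      map_one' := by simp [hφ.1]
      map_mul' := fun x y => by
        ext v
        simp only [map_mul, mul_inv_rev, hφ.2, LinearMap.smul_apply, Module.End.mul_apply,
          map_smul, smul_smul] }
  let _ : Invertible (Nat.card B : ℂ) := invertibleOfNonzero natCast_card_ne_zero
  have h := card_inv_mul_sum_char_eq_finrank τ
  have e : invariants τ = weightSpace ρ ι φ := by
    ext v
    refine forall_congr' fun b => ?_
    change φ b⁻¹ • ρ (ι b) v = v ↔ _
    rw [hφ.map_inv, inv_smul_eq_iff₀ (hφ.ne_zero b)]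
  rw [e] at h
  rw [← h, pair]
  congr 1
  refine Finset.sum_congr rfl fun b _ => ?_
  simp [character, τ, mul_comm]

theorem pair_ne_zero_iff_weightSpace [Finite B] [FiniteDimensional ℂ V]
    (ρ : Representation ℂ Q V) (ι : B →* Q) {φ : B → ℂ} (hφ : IsLin φ) :
    pair (ρ.character ∘ ι) φ ≠ 0 ↔ weightSpace ρ ι φ ≠ ⊥ := by
  rw [pair_eq_finrank_weightSpace ρ ι hφ]
  simp

/-- Only the operators need to commute: the action factors through an abelian quotient of `B`, whose
irreducible characters are linear. -/
theorem exists_weightSpace_ne_bot [Finite B] [FiniteDimensional ℂ V] [Nontrivial V]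
    (ρ : Representation ℂ Q V) (ι : B →* Q)
    (hcomm : ∀ x y, ρ (ι x) * ρ (ι y) = ρ (ι y) * ρ (ι x)) :
    ∃ φ : B → ℂ, IsLin φ ∧ weightSpace ρ ι φ ≠ ⊥ := by
  let f : B →* Module.End ℂ V := (ρ : Q →* Module.End ℂ V).comp ι
  let N := f.ker
  let τ : Representation ℂ (B ⧸ N) V := QuotientGroup.lift N f fun x hx => hx
  have : IsMulCommutative (B ⧸ N) := ⟨⟨fun x y => by
    induction x using QuotientGroup.induction_on with | _ x
    induction y using QuotientGroup.induction_on with | _ y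
    rw [← QuotientGroup.mk_mul, ← QuotientGroup.mk_mul, QuotientGroup.eq]
    change f _ = 1
    have h : f (x * y) = f (y * x) := by
      rw [map_mul, map_mul]; exact hcomm x y
    rw [map_mul, ← h, ← map_mul, inv_mul_cancel, map_one]⟩⟩
  obtain ⟨s, hs, e⟩ := exists_multiset_irrChar τ
  have h1 : s ≠ 0 := by
    rintro rfl
    have := congrFun e 1
    simp at this
    exact Module.finrank_pos.ne' this
  obtain ⟨χ, hχ⟩ := Multiset.exists_mem_of_ne_zero h1
  have hlin := (hs χ hχ).isLin_of_comm
  have h2 := pair_ne_zero_of_mem hs hχ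
  rw [← e] at h2
  have h3 := (pair_ne_zero_iff_weightSpace τ (MonoidHom.id _) hlin).mp h2
  refine ⟨fun b => χ (QuotientGroup.mk b), ⟨hlin.1, fun x y => hlin.2 (QuotientGroup.mk x) (QuotientGroup.mk y)⟩, ?_⟩
  obtain ⟨v, hv, hv0⟩ := Submodule.exists_mem_ne_zero_of_ne_bot h3
  exact Submodule.ne_bot_iff _ |>.mpr ⟨v, fun b => hv (QuotientGroup.mk b), hv0⟩

end Weight

/-! ### The Clifford correspondence over a linear character. -/

section Clifford

variable {G : Type*} [Group G] [Finite G]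

/-- Invariance of `θ` makes its weight space stable under `K`; being non-zero, it is everything by
irreducibility. -/
theorem apply_eq_smul_of_liesAbove {A K : Subgroup G} (hAK : A ≤ K)
    (hn : ∀ k ∈ K, k ∈ Subgroup.normalizer (A : Set G)) {θ : A → ℂ} (hθ : IsLin θ)
    (hinv : ∀ k (hk : k ∈ K), conjChar θ k (hn k hk) = θ) {V : Type*} [AddCommGroup V]
    [Module ℂ V] [FiniteDimensional ℂ V] (ρ : Representation ℂ K V) (hρ : ρ.IsIrreducible)
    (h : LiesAbove ρ.character θ) (a : A) (v : V) :
    ρ (Subgroup.inclusion hAK a) v = θ a • v := by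
  have h1 := (pair_ne_zero_iff_weightSpace ρ (Subgroup.inclusion hAK) hθ).mp
    ((liesAbove_iff hAK _ hθ).mp h)
  have h2 := ((isIrreducible_iff ρ).mp hρ).2 (weightSpace ρ (Subgroup.inclusion hAK) θ) ?_
  · have h3 : v ∈ weightSpace ρ (Subgroup.inclusion hAK) θ := by
      rw [h2.resolve_left h1]; trivial
    exact h3 a
  · intro k v hv b
    have hk := K.inv_mem k.2
    let b' : A := ⟨(k : G)⁻¹ * b * (k : G)⁻¹⁻¹,
      (Subgroup.mem_normalizer_iff.mp (hn _ hk) b).mp b.2⟩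
    have e1 : Subgroup.inclusion hAK b * k = k * Subgroup.inclusion hAK b' := by
      ext; simp [b', mul_assoc]
    have e2 : θ b' = θ b := congrFun (hinv _ hk) b
    have e3 : ρ (Subgroup.inclusion hAK b) (ρ k v) = ρ k (ρ (Subgroup.inclusion hAK b') v) := by
      rw [← Module.End.mul_apply, ← map_mul, e1, map_mul, Module.End.mul_apply]
    rw [e3, hv b', map_smul, e2]

omit [Finite G] in
theorem isOver_of_apply_eq_smul {A K : Subgroup G} (hAK : A ≤ K) {θ : A → ℂ} {V : Type*}
    [AddCommGroup V] [Module ℂ V] (ρ : Representation ℂ K V)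
    (h : ∀ a v, ρ (Subgroup.inclusion hAK a) v = θ a • v) : IsOver θ ρ.character := by
  intro a g
  by_cases hg : g ∈ K
  · have ha : (a : G) * g ∈ K := K.mul_mem (hAK a.2) hg
    rw [zext_of_mem _ hg, zext_of_mem _ ha]
    have : (⟨a * g, ha⟩ : K) = Subgroup.inclusion hAK a * ⟨g, hg⟩ := rfl
    have h' : ρ (Subgroup.inclusion hAK a * ⟨g, hg⟩) = θ a • ρ ⟨g, hg⟩ := by
      rw [map_mul]
      exact LinearMap.ext fun v => h a _
    rw [this, character, h', map_smul, smul_eq_mul, character]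
  · rw [zext_of_notMem _ hg, zext_of_notMem, mul_zero]
    rwa [K.mul_mem_cancel_left (hAK a.2)]

theorem isOver_of_liesAbove {A K : Subgroup G} (hAK : A ≤ K)
    (hn : ∀ k ∈ K, k ∈ Subgroup.normalizer (A : Set G)) {θ : A → ℂ} (hθ : IsLin θ)
    (hinv : ∀ k (hk : k ∈ K), conjChar θ k (hn k hk) = θ) {ψ : K → ℂ} (hψ : ψ ∈ Irr K)
    (h : LiesAbove ψ θ) : IsOver θ ψ := by
  obtain ⟨n, ρ, hρ, rfl⟩ := hψ
  exact isOver_of_apply_eq_smul hAK ρ (apply_eq_smul_of_liesAbove hAK hn hθ hinv ρ hρ h)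

variable {H B : Subgroup G} {φ : B → ℂ}

theorem isOver_inertia (hBH : B ≤ H) (hφ : IsLin φ) {ψ : inertia H φ → ℂ}
    (hψ : ψ ∈ Irr (inertia H φ)) (h : LiesAbove ψ φ) : IsOver φ ψ :=
  isOver_of_liesAbove (hφ.le_inertia hBH) (fun _ hk => hk.2.1) hφ (fun _ hk => hk.2.2) hψ h

omit [Finite G] in
theorem apply_one_ne_zero {K : Subgroup G} {ψ : K → ℂ} (hψ : ψ ∈ Irr K) : ψ 1 ≠ 0 := by
  obtain ⟨n, ρ, hρ, rfl⟩ := hψ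
  have := ((isIrreducible_iff ρ).mp hρ).1
  rw [char_one]
  exact_mod_cast Module.finrank_pos.ne'

theorem star_apply_of_mem_irr {K : Subgroup G} {ψ : K → ℂ} (hψ : ψ ∈ Irr K) (x : K) :
    starRingEnd ℂ (ψ x) = ψ x⁻¹ := by
  obtain ⟨n, ρ, -, rfl⟩ := hψ
  exact star_character ρ x

/-- No induced representation is built: `ψ^H` has norm one and a non-zero multiplicity, natural by
reciprocity, in some irreducible `χ`, so it equals `χ`. -/
theorem indChar_mem_irr (hB : ∀ x ∈ H, x ∈ Subgroup.normalizer (B : Set G)) (hBH : B ≤ H)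
    (hφ : IsLin φ) {ψ : inertia H φ → ℂ} (hψ : ψ ∈ Irr (inertia H φ)) (h : IsOver φ ψ) :
    indChar ψ H ∈ Irr H := by
  have hc := isClassFun_of_mem_irr hψ
  have h1 : indChar ψ H 1 ≠ 0 := by
    rw [indChar_apply]
    simp only [OneMemClass.coe_one, mul_one, mul_inv_cancel]
    have : zext ψ 1 = ψ 1 := zext_coe ψ 1
    rw [this, Finset.sum_const, Finset.card_univ, Fintype.card_eq_nat_card, nsmul_eq_mul]
    exact mul_ne_zero (inv_ne_zero natCast_card_ne_zero)
      (mul_ne_zero natCast_card_ne_zero (apply_one_ne_zero hψ))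
  obtain ⟨χ, hχ, hne⟩ := exists_irrChar_pair_ne_zero h1
  have e1 : ∃ m : ℕ, pair χ (indChar ψ H) = m := by
    have hcl := isClassFun_of_mem_irr (K := H) hχ
    obtain ⟨n, ρ, hρ, rfl⟩ := hχ
    rw [pair_comm, pair_indChar (inertia_le H φ) _ hcl, pair_comm]
    exact exists_nat_pair (ρ.comp (Subgroup.inclusion (inertia_le H φ))) hψ
  obtain ⟨m, hm⟩ := e1
  have e2 : pair (indChar ψ H) (indChar ψ H) = 1 := by
    rw [pair_indChar_indChar hB hBH hφ hc h hc h]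
    exact (pair_irrChar hψ hψ).1 rfl
  rw [← eq_of_pair_eq_natCast (star_indChar (star_apply_of_mem_irr hψ)) e2 hχ hm
    fun h0 => hne (by rw [hm, h0, Nat.cast_zero])]
  exact hχ

/-- Every irreducible character of `H` above `φ` is induced from the inertia group of `φ`. -/
theorem exists_clifford_correspondent (hB : ∀ x ∈ H, x ∈ Subgroup.normalizer (B : Set G))
    (hBH : B ≤ H) (hφ : IsLin φ) {χ : H → ℂ} (hχ : χ ∈ Irr H) (h : LiesAbove χ φ) :
    ∃ ψ ∈ Irr (inertia H φ), LiesAbove ψ φ ∧ IsOver φ ψ ∧ indChar ψ H = χ := by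
  have hBI := hφ.le_inertia hBH
  have hcl := isClassFun_of_mem_irr hχ
  have hχ' := hχ
  obtain ⟨n, ρ, hρ, rfl⟩ := hχ
  obtain ⟨s, hs, e⟩ := exists_multiset_irrChar (ρ.comp (Subgroup.inclusion (inertia_le H φ)))
  have e' : ρ.character ∘ Subgroup.inclusion (inertia_le H φ) = s.sum := e
  rw [liesAbove_iff hBH _ hφ] at h
  have h1 : ∃ ψ ∈ s, pair (ψ ∘ Subgroup.inclusion hBI) φ ≠ 0 := by
    by_contra! hcon
    apply h
    have e2 : ρ.character ∘ Subgroup.inclusion hBH =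
        (s.map fun ψ => ψ ∘ Subgroup.inclusion hBI).sum := by
      funext b
      rw [multiset_sum_apply, Multiset.map_map]
      change (ρ.character ∘ Subgroup.inclusion (inertia_le H φ)) (Subgroup.inclusion hBI b) = _
      rw [e', multiset_sum_apply]
      rfl
    rw [e2, pair_multiset_sum_left, Multiset.map_map]
    exact Multiset.sum_eq_zero fun x hx => by
      obtain ⟨ψ, hψ, rfl⟩ := Multiset.mem_map.mp hx
      exact hcon ψ hψ
  obtain ⟨ψ, hψs, hψ⟩ := h1
  have hirr : ψ ∈ Irr (inertia H φ) := hs ψ hψs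
  have hab : LiesAbove ψ φ := (liesAbove_iff hBI _ hφ).mpr hψ
  have hov := isOver_inertia hBH hφ hirr hab
  refine ⟨ψ, hirr, hab, hov, ?_⟩
  have hne : pair (indChar ψ H) ρ.character ≠ 0 := by
    rw [pair_indChar (inertia_le H φ) _ hcl, e', pair_comm]
    exact pair_ne_zero_of_mem hs hψs
  by_contra hcon
  exact hne ((pair_irrChar (indChar_mem_irr hB hBH hφ hirr hov) hχ').2 hcon)

end Clifford

/-! ### Kernels of linear and induced characters, and their relation to inertia groups. -/

section Kernel

variable {G : Type*} [Group G]

theorem NormalIn.mem_normalizer {K L : Subgroup G} (h : NormalIn K L) {x : G} (hx : x ∈ L) :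
    x ∈ Subgroup.normalizer (K : Set G) := by
  have key : ∀ y ∈ L, ∀ g ∈ K, y * g * y⁻¹ ∈ K := fun y hy g hg =>
    h.2.conj_mem ⟨g, h.1 hg⟩ hg ⟨y, hy⟩
  rw [Subgroup.mem_normalizer_iff]
  refine fun g => ⟨key x hx g, fun hg => ?_⟩
  have := key x⁻¹ (L.inv_mem hx) _ hg
  simpa [mul_assoc] using this

theorem mem_charKer_iff {K : Subgroup G} {φ : K → ℂ} (hφ : IsLin φ) (g : G) :
    g ∈ charKer φ ↔ zext φ g = 1 := by
  constructor
  · rintro ⟨hg, e⟩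
    rw [zext_of_mem _ hg, e, hφ.1]
  · intro e
    by_cases hg : g ∈ K
    · exact ⟨hg, by rw [← zext_of_mem φ hg, e, hφ.1]⟩
    · rw [zext_of_notMem _ hg] at e
      exact absurd e zero_ne_one

/-- The kernel of a linear character, as a subgroup of the ambient group. -/
def linKer {K : Subgroup G} {φ : K → ℂ} (hφ : IsLin φ) : Subgroup G where
  carrier := charKer φ
  one_mem' := ⟨K.one_mem, rfl⟩
  mul_mem' := by
    rintro a b ⟨ha, ea⟩ ⟨hb, eb⟩
    refine ⟨K.mul_mem ha hb, ?_⟩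
    have : (⟨a * b, K.mul_mem ha hb⟩ : K) = ⟨a, ha⟩ * ⟨b, hb⟩ := rfl
    rw [this, hφ.2, ea, eb, hφ.1, one_mul]
  inv_mem' := by
    rintro a ⟨ha, ea⟩
    refine ⟨K.inv_mem ha, ?_⟩
    have : (⟨a⁻¹, K.inv_mem ha⟩ : K) = ⟨a, ha⟩⁻¹ := rfl
    rw [this, hφ.map_inv, ea, hφ.1, inv_one]

theorem charKer_subset {K : Subgroup G} (φ : K → ℂ) : charKer φ ⊆ K := fun _ h => h.1

theorem mem_charKer_indChar_top [Finite G] {K : Subgroup G} {ψ : K → ℂ} {g : G} :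
    g ∈ charKer (indChar ψ (⊤ : Subgroup G)) ↔
      ∑ x : (⊤ : Subgroup G), zext ψ ((x : G) * g * (x : G)⁻¹) =
        ∑ _x : (⊤ : Subgroup G), ψ 1 := by
  have h1 : ∀ x : (⊤ : Subgroup G), zext ψ ((x : G) * ((1 : (⊤ : Subgroup G)) : G) * (x : G)⁻¹) =
      ψ 1 := fun x => by
    rw [OneMemClass.coe_one, mul_one, mul_inv_cancel]
    exact zext_coe ψ 1
  have h2 : g ∈ charKer (indChar ψ (⊤ : Subgroup G)) ↔
      indChar ψ (⊤ : Subgroup G) ⟨g, trivial⟩ = indChar ψ ⊤ 1 :=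
    ⟨fun ⟨_, e⟩ => e, fun e => ⟨trivial, e⟩⟩
  rw [h2, indChar_apply, indChar_apply, mul_right_inj' (inv_ne_zero natCast_card_ne_zero)]
  simp only [h1]

/-- The values of `φ`, extended by zero, lie in the unit disc, so their sum over the conjugates of
`g` is the number of summands only if each is `1`. -/
theorem mem_charKer_indChar_of_isLin [Finite G] {K : Subgroup G} {φ : K → ℂ} (hφ : IsLin φ)
    {g : G} : g ∈ charKer (indChar φ (⊤ : Subgroup G)) ↔ ∀ x : G, zext φ (x * g * x⁻¹) = 1 := by
  rw [mem_charKer_indChar_top, hφ.1]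
  constructor
  · intro h x
    have hn : ∀ y, ‖zext φ y‖ ≤ 1 := fun y => by
      by_cases hy : y ∈ K
      · rw [zext_of_mem _ hy, hφ.norm]
      · rw [zext_of_notMem _ hy, norm_zero]; exact zero_le_one
    have h1 : ∑ x : (⊤ : Subgroup G), (1 - (zext φ ((x : G) * g * (x : G)⁻¹)).re) = 0 := by
      rw [Finset.sum_sub_distrib, ← Complex.re_sum, h]
      simp
    rw [Finset.sum_eq_zero_iff_of_nonneg fun x _ =>
      sub_nonneg.mpr ((Complex.re_le_norm _).trans (hn _))] at h1
    have h2 := h1 ⟨x, trivial⟩ (Finset.mem_univ _)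
    have h3 := hn (x * g * x⁻¹)
    set z := zext φ (x * g * x⁻¹)
    have hre : z.re = 1 := by
      linarith
    have hsq : z.re ^ 2 + z.im ^ 2 = ‖z‖ ^ 2 := by
      rw [← Complex.normSq_eq_norm_sq, Complex.normSq_apply]; ring
    have him : z.im = 0 := by
      have : ‖z‖ ^ 2 ≤ 1 := by nlinarith [norm_nonneg z]
      rw [hre] at hsq
      nlinarith [sq_nonneg z.im]
    exact Complex.ext hre him
  · intro h
    simp only [h]

/-- Describes the inertia group through `charKer φ` alone, so that whatever in `H` normalizes the
kernel normalizes the inertia group. -/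
theorem mem_inertia_iff {H B : Subgroup G} {φ : B → ℂ} (hφ : IsLin φ)
    (hB : ∀ x ∈ H, x ∈ Subgroup.normalizer (B : Set G)) {g : G} (hg : g ∈ H) :
    g ∈ inertia H φ ↔ ∀ b ∈ B, g * b * g⁻¹ * b⁻¹ ∈ charKer φ := by
  have hmem : ∀ b ∈ B, g * b * g⁻¹ ∈ B := fun b hb =>
    (Subgroup.mem_normalizer_iff.mp (hB g hg) b).mp hb
  have key : ∀ b (hb : b ∈ B), g * b * g⁻¹ * b⁻¹ ∈ charKer φ ↔
      conjChar φ g (hB g hg) ⟨b, hb⟩ = φ ⟨b, hb⟩ := fun b hb => by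
    rw [mem_charKer_iff hφ, zext_of_mem φ (B.mul_mem (hmem b hb) (B.inv_mem hb))]
    have : (⟨g * b * g⁻¹ * b⁻¹, B.mul_mem (hmem b hb) (B.inv_mem hb)⟩ : B) =
        ⟨g * b * g⁻¹, hmem b hb⟩ * ⟨b, hb⟩⁻¹ := rfl
    rw [this, hφ.2, hφ.map_inv, mul_inv_eq_one₀ (hφ.ne_zero _)]
    rfl
  constructor
  · rintro ⟨_, _, e⟩ b hb
    exact (key b hb).mpr (congrFun e ⟨b, hb⟩)
  · intro h
    exact ⟨hg, hB g hg, funext fun b => (key b b.2).mp (h b b.2)⟩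

theorem normalIn_inertia {H B : Subgroup G} {φ : B → ℂ} (hφ : IsLin φ) (hBH : NormalIn B H) :
    NormalIn (inertia H φ) (H ⊓ Subgroup.normalizer (charKer φ)) := by
  have hB : ∀ x ∈ H, x ∈ Subgroup.normalizer (B : Set G) := fun x hx => hBH.mem_normalizer hx
  constructor
  · intro g hg
    refine ⟨hg.1, Subgroup.mem_set_normalizer_iff.mpr fun b => ?_⟩
    obtain ⟨_, hn, e⟩ := hg
    rw [mem_charKer_iff hφ, mem_charKer_iff hφ]
    by_cases hb : b ∈ B
    · rw [zext_conj_eq φ hn ⟨b, hb⟩, e, zext_of_mem _ hb]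
    · rw [zext_of_notMem _ hb, zext_of_notMem _
        fun h => hb ((Subgroup.mem_normalizer_iff.mp hn b).mpr h)]
  · refine ⟨fun g hg n => ?_⟩
    change (n : G) * g * (n : G)⁻¹ ∈ inertia H φ
    have hgH : (g : G) ∈ H := g.2.1
    have hnH : (n : G) ∈ H := n.2.1
    rw [mem_inertia_iff hφ hB (H.mul_mem (H.mul_mem hnH hgH) (H.inv_mem hnH))]
    intro b hb
    have hb' : (n : G)⁻¹ * b * (n : G)⁻¹⁻¹ ∈ B :=
      (Subgroup.mem_normalizer_iff.mp (hB _ (H.inv_mem hnH)) b).mp hb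
    have h1 := (mem_inertia_iff hφ hB hgH).mp hg _ hb'
    have h2 := (Subgroup.mem_set_normalizer_iff.mp n.2.2 _).mp h1
    convert h2 using 1
    group

end Kernel

/-! ### Maximal abelian normal subgroups over `ker θ`. -/

section Maximal

variable {G : Type*} [Group G] {T : Triple G}

theorem Triple.IsCharTriple.conj_mem_charKer (hT : T.IsCharTriple) (hθ : IsLin T.θ) {h g : G}
    (hh : h ∈ T.H) (hg : g ∈ charKer T.θ) : h * g * h⁻¹ ∈ charKer T.θ := by
  obtain ⟨hn, e⟩ := hT.2.2 h hh
  rw [mem_charKer_iff hθ] at hg ⊢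
  have hgA : g ∈ T.A := by
    by_contra hc
    rw [zext_of_notMem _ hc] at hg
    exact zero_ne_one hg
  rw [zext_conj_eq T.θ hn ⟨g, hgA⟩, e, ← hg, zext_of_mem]

theorem normal_linKer (hT : T.IsCharTriple) (hθ : IsLin T.θ) :
    ((linKer hθ).subgroupOf T.H).Normal :=
  ⟨fun _ hg h => hT.conj_mem_charKer hθ h.2 hg⟩

/-- Invariance of `θ` in `H` says that `A / ker θ` is central in `H / ker θ`. -/
theorem commutator_mem_charKer (hT : T.IsCharTriple) (hθ : IsLin T.θ) {a h : G} (ha : a ∈ T.A)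
    (hh : h ∈ T.H) : h * a * h⁻¹ * a⁻¹ ∈ charKer T.θ := by
  have : h ∈ inertia T.H T.θ := ⟨hh, hT.2.2 h hh⟩
  exact (mem_inertia_iff hθ (fun x hx => hT.1.mem_normalizer hx) hh).mp this a ha

theorem mk_commute_of_mem (hT : T.IsCharTriple) (hθ : IsLin T.θ)
    [((linKer hθ).subgroupOf T.H).Normal] {a : T.H} (ha : (a : G) ∈ T.A) (h : T.H) :
    (QuotientGroup.mk a : T.H ⧸ (linKer hθ).subgroupOf T.H) * QuotientGroup.mk h =
      QuotientGroup.mk h * QuotientGroup.mk a := by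
  rw [← QuotientGroup.mk_mul, ← QuotientGroup.mk_mul, eq_comm, QuotientGroup.eq]
  have h1 := commutator_mem_charKer hT hθ ha (T.H.inv_mem h.2)
  have h2 := hT.conj_mem_charKer hθ (T.H.inv_mem a.2) h1
  have e : (((h * a)⁻¹ * (a * h) : T.H) : G) =
      (a : G)⁻¹ * ((h : G)⁻¹ * a * (h : G)⁻¹⁻¹ * (a : G)⁻¹) * (a : G)⁻¹⁻¹ := by
    push_cast
    group
  change (((h * a)⁻¹ * (a * h) : T.H) : G) ∈ charKer T.θ
  rwa [e]

/-- An abelian normal subgroup of `H ⧸ ker θ`, multiplied by the image of `A`, gives a normal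
subgroup of `H` that is abelian modulo `ker θ`. -/
theorem exists_isAbelianNormalOverKer (hT : T.IsCharTriple) (hθ : IsLin T.θ)
    [((linKer hθ).subgroupOf T.H).Normal]
    (C : Subgroup (T.H ⧸ (linKer hθ).subgroupOf T.H)) (hC : C.Normal)
    (hcomm : ∀ a ∈ C, ∀ b ∈ C, a * b = b * a) :
    ∃ B : Subgroup G, T.IsAbelianNormalOverKer B ∧ T.A ≤ B ∧
      ∀ h : T.H, (QuotientGroup.mk h : T.H ⧸ (linKer hθ).subgroupOf T.H) ∈ C → (h : G) ∈ B := by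
  let π := QuotientGroup.mk' ((linKer hθ).subgroupOf T.H)
  let D := (T.A.subgroupOf T.H).map π
  have hDc : D ≤ Subgroup.center _ := by
    rintro _ ⟨a, ha, rfl⟩
    rw [Subgroup.mem_center_iff]
    intro q
    obtain ⟨h, rfl⟩ := QuotientGroup.mk'_surjective _ q
    exact (mk_commute_of_mem hT hθ ha h).symm
  have hD : D.Normal := by
    have : (T.A.subgroupOf T.H).Normal := hT.1.2
    exact this.map π (QuotientGroup.mk'_surjective _)
  have hCD : C ⊔ D ≤ Subgroup.centralizer (C ⊔ D : Subgroup _) := by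
    have h1 : C ⊔ D ≤ Subgroup.centralizer C := by
      refine sup_le (fun a ha => ?_) (hDc.trans (Subgroup.center_le_centralizer _))
      rw [Subgroup.mem_centralizer_iff]
      exact fun b hb => hcomm b hb a ha
    exact sup_le (Subgroup.le_centralizer_iff.mp h1)
      (hDc.trans (Subgroup.center_le_centralizer _))
  refine ⟨((C ⊔ D).comap π).map T.H.subtype, ⟨⟨?_, ?_⟩, ?_, ?_⟩, ?_, ?_⟩
  · rintro _ ⟨h, _, rfl⟩
    exact h.2
  · have : ((C ⊔ D).comap π).Normal := inferInstance
    have e : (((C ⊔ D).comap π).map T.H.subtype).subgroupOf T.H = (C ⊔ D).comap π :=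
      Subgroup.comap_map_eq_self_of_injective T.H.subtype_injective _
    rwa [e]
  · intro g hg
    refine ⟨⟨g, hT.1.1 (charKer_subset _ hg)⟩, ?_, rfl⟩
    have : π ⟨g, hT.1.1 (charKer_subset _ hg)⟩ = 1 :=
      (QuotientGroup.eq_one_iff _).mpr hg
    change π _ ∈ C ⊔ D
    rw [this]
    exact one_mem _
  · rintro _ ⟨x, hx, rfl⟩ _ ⟨y, hy, rfl⟩
    have h1 : π (x⁻¹ * y⁻¹ * x * y) = 1 := by
      have := Subgroup.mem_centralizer_iff.mp (hCD hx) (π y) hy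
      rw [map_mul, map_mul, map_mul, mul_assoc, ← this, map_inv, map_inv]
      group
    exact (QuotientGroup.eq_one_iff _).mp h1
  · intro a ha
    exact ⟨⟨a, hT.1.1 ha⟩, (le_sup_right : D ≤ C ⊔ D) ⟨_, ha, rfl⟩, rfl⟩
  · intro h hh
    exact ⟨h, (le_sup_left : C ≤ C ⊔ D) hh, rfl⟩

variable [Finite G] {𝒜 : Subgroup G}

theorem Triple.IsMaxAbelianNormal.lt (hG : InClassC G) (hT : T.IsCharTriple) (hθ : IsLin T.θ)
    (hHA : T.H ≠ T.A) (h𝒜 : T.IsMaxAbelianNormal 𝒜) : T.A < 𝒜 := by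
  have hK := normal_linKer hT hθ
  -- The product of `𝒜` and `A` is still admissible, since `A` is central modulo `ker θ`; by
  -- maximality it is `𝒜`.
  have hle : T.A ≤ 𝒜 := by
    have hn : (𝒜.subgroupOf T.H).Normal := h𝒜.1.1.2
    obtain ⟨B, hB, hAB, hCB⟩ := exists_isAbelianNormalOverKer hT hθ
      ((𝒜.subgroupOf T.H).map (QuotientGroup.mk' _))
      (hn.map _ (QuotientGroup.mk'_surjective _)) (by
        rintro _ ⟨x, hx, rfl⟩ _ ⟨y, hy, rfl⟩
        rw [← map_mul, ← map_mul, eq_comm, QuotientGroup.mk'_eq_mk']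
        exact ⟨x⁻¹ * y⁻¹ * x * y, h𝒜.1.2.2 x hx y hy, by group⟩)
    have h1 : 𝒜 ≤ B := fun a ha => hCB ⟨a, h𝒜.1.1.1 ha⟩ ⟨_, ha, rfl⟩
    have h2 : 𝒜 = B := Subgroup.eq_of_le_of_card_ge h1 (h𝒜.2 B hB)
    rw [h2]; exact hAB
  refine lt_of_le_of_ne hle fun e => ?_
  -- Suppose `𝒜 = A`. If `H / ker θ` is abelian, then `H` is admissible and `H = A`. Otherwise
  -- maximality puts the non-central `C` inside the image of `A`, which is central.
  rcases hG T.H ((linKer hθ).subgroupOf T.H) with hab | ⟨C, hC, hcomm, hnc⟩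
  · obtain ⟨B, hB, -, hCB⟩ := exists_isAbelianNormalOverKer hT hθ ⊤ inferInstance
      fun a _ b _ => hab a b
    have h1 : T.H ≤ B := fun h hh => hCB ⟨h, hh⟩ trivial
    have h2 : T.H = B := le_antisymm h1 hB.1.1
    have h3 := h𝒜.2 B hB
    rw [← h2, ← e] at h3
    exact hHA (Subgroup.eq_of_le_of_card_ge hT.1.1 h3).symm
  · obtain ⟨B, hB, hAB, hCB⟩ := exists_isAbelianNormalOverKer hT hθ C hC hcomm
    have h3 := h𝒜.2 B hB
    rw [← e] at h3
    have h4 : T.A = B := Subgroup.eq_of_le_of_card_ge hAB h3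
    apply hnc
    intro q hq
    obtain ⟨x, rfl⟩ := QuotientGroup.mk_surjective q
    have hx : (x : G) ∈ T.A := by rw [h4]; exact hCB x hq
    rw [Subgroup.mem_center_iff]
    intro r
    obtain ⟨y, rfl⟩ := QuotientGroup.mk_surjective r
    exact (mk_commute_of_mem hT hθ hx y).symm

theorem Triple.IsMaxAbelianNormal.eq_iff (hT : T.IsCharTriple) {φ : 𝒜 → ℂ}
    (hφ : IsLin φ) (h𝒜 : T.IsMaxAbelianNormal 𝒜) :
    (𝒜 = T.H ∧ T.H = inertia T.H φ) ↔ AbelianModulo T.H (charKer T.θ) := by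
  constructor
  · rintro ⟨e, -⟩
    rw [← e]
    exact h𝒜.1.2.2
  · intro h
    have h1 : T.IsAbelianNormalOverKer T.H :=
      ⟨⟨le_rfl, by rw [Subgroup.subgroupOf_self]; infer_instance⟩,
        (charKer_subset _).trans hT.1.1, h⟩
    have h2 : 𝒜 = T.H := Subgroup.eq_of_le_of_card_ge h𝒜.1.1.1 (h𝒜.2 _ h1)
    exact ⟨h2, le_antisymm (h2.symm.le.trans (hφ.le_inertia h𝒜.1.1.1)) (inertia_le _ _)⟩

end Maximal

/-! ### Conjugation and field automorphisms acting on characters. -/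

section Conjugation

variable {G : Type*} [Group G]

theorem zext_comp_conjChar {K : Subgroup G} (σ : ℂ ≃+* ℂ) (ψ : K → ℂ) {x : G}
    (hx : x ∈ Subgroup.normalizer (K : Set G)) (g : G) :
    zext (σ ∘ conjChar ψ x hx) g = σ (zext ψ (x * g * x⁻¹)) := by
  by_cases hg : g ∈ K
  · rw [zext_of_mem _ hg, zext_of_mem _ ((Subgroup.mem_normalizer_iff.mp hx g).mp hg)]
    rfl
  · rw [zext_of_notMem _ hg, zext_of_notMem _
      fun h => hg ((Subgroup.mem_normalizer_iff.mp hx g).mpr h), map_zero]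

theorem IsLin.galois {Q : Type*} [Group Q] {φ : Q → ℂ} (h : IsLin φ) (σ : ℂ ≃+* ℂ) :
    IsLin (σ ∘ φ) :=
  ⟨by simp [h.1], fun x y => by simp [h.2]⟩

theorem IsClassFun.conjChar {K : Subgroup G} {ψ : K → ℂ} (h : IsClassFun ψ) {x : G}
    (hx : x ∈ Subgroup.normalizer (K : Set G)) : IsClassFun (conjChar ψ x hx) := by
  intro y g
  refine Eq.trans ?_ (h ⟨x * y * x⁻¹, (Subgroup.mem_normalizer_iff.mp hx y).mp y.2⟩ _)
  unfold NLin.conjChar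
  congr 1
  ext
  simp [mul_assoc]

theorem IsOver.comp_conjChar {B K : Subgroup G} {φ : B → ℂ} {ψ : K → ℂ} (h : IsOver φ ψ)
    (σ : ℂ ≃+* ℂ) {x : G} (hxB : x ∈ Subgroup.normalizer (B : Set G))
    (hxK : x ∈ Subgroup.normalizer (K : Set G)) :
    IsOver (σ ∘ NLin.conjChar φ x hxB) (σ ∘ NLin.conjChar ψ x hxK) := by
  intro b g
  rw [zext_comp_conjChar, zext_comp_conjChar]
  have e : x * (b * g) * x⁻¹ = (x * b * x⁻¹) * (x * g * x⁻¹) := by group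
  rw [e]
  have := h ⟨x * b * x⁻¹, (Subgroup.mem_normalizer_iff.mp hxB b).mp b.2⟩ (x * g * x⁻¹)
  rw [this, map_mul]
  rfl

variable [Finite G]

/-- Conjugation by `x ∈ H` only reindexes the sum over `H` that defines the induced character. -/
theorem indChar_comp_conjChar {K H : Subgroup G} (σ : ℂ ≃+* ℂ) (ψ : K → ℂ) {x : G}
    (hx : x ∈ Subgroup.normalizer (K : Set G)) (hxH : x ∈ H) :
    indChar (σ ∘ conjChar ψ x hx) H = σ ∘ indChar ψ H := by
  rw [← indChar_comp_ringEquiv]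
  funext g
  rw [indChar_apply, indChar_apply]
  congr 1
  rw [← Equiv.sum_comp (Equiv.mulLeft (⟨x, hxH⟩ : H))
    fun y : H => zext (σ ∘ ψ) ((y : G) * g * (y : G)⁻¹)]
  refine Finset.sum_congr rfl fun y _ => ?_
  have e : (Equiv.mulLeft (⟨x, hxH⟩ : H) y : G) * g * (Equiv.mulLeft (⟨x, hxH⟩ : H) y : G)⁻¹ =
      x * ((y : G) * g * (y : G)⁻¹) * x⁻¹ := by
    simp [mul_assoc]
  rw [zext_comp_conjChar, e]
  generalize x * ((y : G) * g * (y : G)⁻¹) * x⁻¹ = z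
  by_cases hz : z ∈ K
  · rw [zext_of_mem _ hz, zext_of_mem _ hz]; rfl
  · rw [zext_of_notMem _ hz, zext_of_notMem _ hz, map_zero]

theorem pair_comp_ringEquiv {Q : Type*} [Group Q] [Finite Q] (σ : ℂ ≃+* ℂ) (f f' : Q → ℂ) :
    pair (σ ∘ f) (σ ∘ f') = σ (pair f f') := by
  simp [pair]

theorem pair_conjChar {H B : Subgroup G} (hBH : B ≤ H) {χ : H → ℂ} (hχ : IsClassFun χ)
    (φ : B → ℂ) {x : G} (hx : x ∈ Subgroup.normalizer (B : Set G)) (hxH : x ∈ H) :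
    pair (χ ∘ Subgroup.inclusion hBH) (conjChar φ x hx) =
      pair (χ ∘ Subgroup.inclusion hBH) φ := by
  unfold pair
  congr 1
  have hmem : ∀ b : G, b ∈ B ↔ x * b * x⁻¹ ∈ B := Subgroup.mem_normalizer_iff.mp hx
  let e : B ≃ B := ((MulAut.conj x).toEquiv).subtypeEquiv hmem
  rw [← Equiv.sum_comp e fun b => (χ ∘ Subgroup.inclusion hBH) b * φ b⁻¹]
  refine Finset.sum_congr rfl fun b _ => ?_
  have e1 : (χ ∘ Subgroup.inclusion hBH) (e b) = (χ ∘ Subgroup.inclusion hBH) b :=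
    hχ ⟨x, hxH⟩ (Subgroup.inclusion hBH b)
  rw [e1]
  congr 1
  unfold conjChar
  congr 1
  ext
  simp [e, mul_assoc]

theorem pair_self_isLin {Q : Type*} [Group Q] [Finite Q] {φ : Q → ℂ} (h : IsLin φ) :
    pair φ φ = 1 :=
  (pair_irrChar h.isIrrChar h.isIrrChar).1 rfl

/-- If characters induced from inertia groups are Galois conjugate, then so are the underlying
linear characters, up to conjugation in `H`. -/
theorem exists_eq_comp_conjChar {H B : Subgroup G}
    (hB : ∀ x ∈ H, x ∈ Subgroup.normalizer (B : Set G)) {φ₁ φ₂ : B → ℂ} (h₁ : IsLin φ₁)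
    (h₂ : IsLin φ₂) {ψ₁ : inertia H φ₁ → ℂ} {ψ₂ : inertia H φ₂ → ℂ} (ho₁ : IsOver φ₁ ψ₁)
    (ho₂ : IsOver φ₂ ψ₂) (hc₂ : IsClassFun ψ₂) (hne : ψ₂ 1 ≠ 0) (σ : ℂ ≃+* ℂ)
    (e : indChar ψ₂ H = σ ∘ indChar ψ₁ H) (hBH : B ≤ H) :
    ∃ x, ∃ hx : x ∈ H, φ₂ = σ ∘ conjChar φ₁ x (hB x hx) := by
  -- If `φ₂` is none of the characters `σ ∘ φ₁^x`, it is orthogonal to each of them, so the average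
  -- over `B` that returns `|B| ψ₂(1)` vanishes.
  by_contra! hcon
  have h := sum_zext_indChar hB h₂ hc₂ ho₂ 1
  have e1 : zext ψ₂ 1 = ψ₂ 1 := zext_coe ψ₂ 1
  refine mul_ne_zero (natCast_card_ne_zero (Q := B)) hne ?_
  rw [← e1, ← h]
  have e2 : ∀ b : B, zext (indChar ψ₂ H) (b * 1) = σ (Nat.card (inertia H φ₁) : ℂ)⁻¹ *
      ∑ x : H, (σ ∘ conjChar φ₁ x (hB x x.2)) b * σ (ψ₁ 1) := fun b => by
    rw [mul_one, e, zext_of_mem _ (hBH b.2), Function.comp,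
      ← zext_of_mem (indChar ψ₁ H) (hBH b.2),
      zext_indChar_eq_sum hB ho₁]
    simp
  simp only [e2, Finset.mul_sum]
  rw [Finset.sum_comm]
  refine Finset.sum_eq_zero fun x _ => ?_
  have e3 := (sum_isLin_inv_mul h₂ ((isLin_conjChar h₁ (hB x x.2)).galois σ)).2
    fun h => hcon x x.2 h.symm
  calc _ = ∑ b : B, (φ₂ b⁻¹ * (σ ∘ conjChar φ₁ x (hB x x.2)) b) *
        (σ (Nat.card (inertia H φ₁) : ℂ)⁻¹ * σ (ψ₁ 1)) :=
        Finset.sum_congr rfl fun b _ => by ring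
    _ = 0 := by rw [← Finset.sum_mul, e3, zero_mul]

omit [Finite G] in
-- A field automorphism does not change kernels, so `ker φ = ker φ^x`.
theorem mem_normalizer_charKer {B : Subgroup G} {φ : B → ℂ} (hφ : IsLin φ) {σ : ℂ ≃+* ℂ} {x : G}
    (hx : x ∈ Subgroup.normalizer (B : Set G)) (e : φ = σ ∘ conjChar φ x hx) :
    x ∈ Subgroup.normalizer (charKer φ) := by
  refine Subgroup.mem_set_normalizer_iff.mpr fun g => ?_
  rw [mem_charKer_iff hφ, mem_charKer_iff hφ]
  have h : zext φ g = σ (zext φ (x * g * x⁻¹)) := by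
    conv_lhs => rw [e]
    exact zext_comp_conjChar σ φ hx g
  rw [h, map_eq_one_iff σ σ.injective]

end Conjugation

/-! ### Direct Clifford correspondents of an `N`-linear triple. -/

section Triples

variable {G : Type*} [Group G] [Finite G] {T : Triple G} {N 𝒜 : Subgroup G}

omit [Finite G] in
theorem Triple.IsNLinear.isLin (hT : T.IsNLinear N) : IsLin T.θ :=
  IsIrrChar.isLin hT.1.2.1 hT.2.1

omit [Finite G] in
theorem isLin_of_mem_linTilde {A B : Subgroup G} {θ : A → ℂ} {φ : B → ℂ}
    (h : φ ∈ LinTilde N B θ) : IsLin φ :=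
  IsIrrChar.isLin h.1.1 h.2

/-- A linear character above the invariant `θ` extends it. -/
theorem zext_eq_of_mem_linTilde (hT : T.IsNLinear N) (hA : T.A ≤ 𝒜) (h𝒜 : 𝒜 ≤ T.H)
    {φ : 𝒜 → ℂ} (hφ : φ ∈ LinTilde N 𝒜 T.θ) (a : T.A) : zext φ a = T.θ a := by
  have h := isOver_of_liesAbove hA (fun k hk => hT.1.1.mem_normalizer (h𝒜 hk)) hT.isLin
    (fun k hk => (hT.1.2.2 k (h𝒜 hk)).2) hφ.1.1 hφ.1.2.1
  rw [h.zext_one_eq, hφ.2, mul_one]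

theorem mapsTo_indChar (hT : T.IsNLinear N) (hA : T.A ≤ 𝒜) (h𝒜 : NormalIn 𝒜 T.H)
    {φ : 𝒜 → ℂ} (hφ : φ ∈ LinTilde N 𝒜 T.θ) :
    Set.MapsTo (fun ψ : inertia T.H φ → ℂ => indChar ψ T.H)
      (IrrTilde N (inertia T.H φ) φ) (IrrTilde N T.H T.θ) := by
  have hlin := isLin_of_mem_linTilde hφ
  have hB : ∀ x ∈ T.H, x ∈ Subgroup.normalizer (𝒜 : Set G) := fun x hx => h𝒜.mem_normalizer hx
  rintro ψ ⟨hψ, hab, hker⟩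
  have hov := isOver_inertia h𝒜.1 hlin hψ hab
  refine ⟨indChar_mem_irr hB h𝒜.1 hlin hψ hov, ?_, ?_⟩
  · rw [liesAbove_iff hT.1.1.1 _ hT.isLin]
    -- All `H`-conjugates of `φ` extend `θ`, so `ψ^H` restricts to `A` as the multiple `|H : I_H(φ)|
    -- ψ(1)` of `θ`.
    have e : indChar ψ T.H ∘ Subgroup.inclusion hT.1.1.1 = fun a =>
        ((Nat.card (inertia T.H φ) : ℂ)⁻¹ * (Nat.card T.H * ψ 1)) * T.θ a := by
      funext a
      have h1 : (indChar ψ T.H ∘ Subgroup.inclusion hT.1.1.1) a = zext (indChar ψ T.H) a :=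
        (zext_of_mem _ (hT.1.1.1 a.2)).symm
      have h2 := zext_indChar_eq_sum hB hov ⟨a, hA a.2⟩
      have h3 : ∀ x : T.H, conjChar φ x (hB x x.2) ⟨a, hA a.2⟩ = T.θ a := fun x => by
        obtain ⟨hn, e⟩ := hT.1.2.2 x x.2
        rw [← zext_conj_eq φ]
        have h4 := zext_eq_of_mem_linTilde hT hA h𝒜.1 hφ
          ⟨x * a * (x : G)⁻¹, (Subgroup.mem_normalizer_iff.mp hn a).mp a.2⟩
        rw [h4]
        exact congrFun e a
      simp only [h3] at h2
      rw [h1, h2, Finset.sum_const, Finset.card_univ, Fintype.card_eq_nat_card, nsmul_eq_mul]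
      ring
    have e2 : pair (indChar ψ T.H ∘ Subgroup.inclusion hT.1.1.1) T.θ =
        ((Nat.card (inertia T.H φ) : ℂ)⁻¹ * (Nat.card T.H * ψ 1)) * pair T.θ T.θ := by
      rw [e]
      simp only [pair, mul_assoc, ← Finset.mul_sum]
      ring
    rw [e2, pair_self_isLin hT.isLin, mul_one]
    exact mul_ne_zero (inv_ne_zero natCast_card_ne_zero)
      (mul_ne_zero natCast_card_ne_zero (apply_one_ne_zero hψ))
  · rw [indChar_indChar (inertia_le _ _) le_top, hker]

theorem injOn_indChar (h𝒜 : NormalIn 𝒜 T.H) {φ : 𝒜 → ℂ} (hφ : IsLin φ) :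
    Set.InjOn (fun ψ : inertia T.H φ → ℂ => indChar ψ T.H) (IrrTilde N (inertia T.H φ) φ) := by
  intro ψ hψ ψ' hψ' e
  exact indChar_injective (fun x hx => h𝒜.mem_normalizer hx) hφ (isClassFun_of_mem_irr hψ.1)
    (isOver_inertia h𝒜.1 hφ hψ.1 hψ.2.1) (isClassFun_of_mem_irr hψ'.1)
    (isOver_inertia h𝒜.1 hφ hψ'.1 hψ'.2.1) e

/-- Below every member of `Irr~(H | θ)` there is a member of `Lin~(𝒜 | θ)`. -/
theorem exists_mem_linTilde (hT : T.IsNLinear N) (hA : T.A ≤ 𝒜) (h𝒜 : NormalIn 𝒜 T.H)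
    (hab : AbelianModulo 𝒜 (charKer T.θ)) {χ : T.H → ℂ} (hχ : χ ∈ IrrTilde N T.H T.θ) :
    ∃ φ ∈ LinTilde N 𝒜 T.θ, LiesAbove χ φ := by
  have hB : ∀ x ∈ T.H, x ∈ Subgroup.normalizer (𝒜 : Set G) := fun x hx => h𝒜.mem_normalizer hx
  obtain ⟨hirr, habove, hker⟩ := hχ
  have hirr' := hirr
  obtain ⟨n, ρ, hρ, rfl⟩ := hirr
  have hθ := apply_eq_smul_of_liesAbove hT.1.1.1 (fun k hk => hT.1.1.mem_normalizer hk) hT.isLin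
    (fun k hk => (hT.1.2.2 k hk).2) ρ hρ habove
  have := ((isIrreducible_iff ρ).mp hρ).1
  obtain ⟨φ, hφ, hw⟩ := exists_weightSpace_ne_bot ρ (Subgroup.inclusion h𝒜.1) fun x y => by
    obtain ⟨hm, e⟩ := hab x x.2 y y.2
    -- Commutators of `𝒜` lie in `ker θ`, and `A` acts by the scalars `θ`.
    have h1 : ρ (Subgroup.inclusion h𝒜.1 (x⁻¹ * y⁻¹ * x * y)) = 1 := by
      refine LinearMap.ext fun v => (hθ ⟨_, hm⟩ v).trans ?_
      rw [e.trans hT.2.1, one_smul]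
      rfl
    rw [← map_mul, ← map_mul, ← map_mul, ← map_mul]
    have h2 : x * y = y * x * (x⁻¹ * y⁻¹ * x * y) := by group
    rw [h2, map_mul, map_mul ρ, h1, mul_one]
  have habφ : LiesAbove ρ.character φ :=
    (liesAbove_iff h𝒜.1 _ hφ).mpr ((pair_ne_zero_iff_weightSpace ρ _ hφ).mpr hw)
  have hres : φ ∘ Subgroup.inclusion hA = T.θ := by
    obtain ⟨v, hv, hv0⟩ := Submodule.exists_mem_ne_zero_of_ne_bot hw
    funext a
    have h1 := hv (Subgroup.inclusion hA a)
    have h2 := hθ a v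
    have h3 : Subgroup.inclusion h𝒜.1 (Subgroup.inclusion hA a) =
      Subgroup.inclusion hT.1.1.1 a := rfl
    rw [h3, h2] at h1
    exact (smul_left_injective ℂ hv0 h1).symm
  refine ⟨φ, ⟨⟨hφ.isIrrChar, ?_, ?_⟩, hφ.1⟩, habφ⟩
  · rw [liesAbove_iff hA _ hT.isLin, hres, pair_self_isLin hT.isLin]
    exact one_ne_zero
  -- If all conjugates of `g` lie in `ker φ`, each of them is in the kernel of every `φ^y` with `y ∈
  -- H`, hence of `χ`, and so `g ∈ ker χ^G = N`. Conversely `N` is the core of `ker θ`, and `ker θ ⊆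
  -- ker φ` as `φ` extends `θ`.
  · refine Set.Subset.antisymm (fun g hg => ?_) (fun g hg => ?_)
    · rw [mem_charKer_indChar_of_isLin hφ] at hg
      rw [← hker, mem_charKer_indChar_top]
      refine Finset.sum_congr rfl fun x _ => ?_
      obtain ⟨ψ, hψ, -, hov, e⟩ := exists_clifford_correspondent hB h𝒜.1 hφ hirr' habφ
      have hmem : (x : G) * g * (x : G)⁻¹ ∈ 𝒜 :=
        charKer_subset φ ((mem_charKer_iff hφ _).mpr (hg x))
      have h1 := zext_indChar_eq_sum hB hov ⟨_, hmem⟩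
      have h2 := zext_indChar_eq_sum hB hov 1
      have h3 : ∀ y : T.H, conjChar φ y (hB y y.2) ⟨_, hmem⟩ = conjChar φ y (hB y y.2) 1 :=
        fun y => by
          rw [(isLin_conjChar hφ (hB y y.2)).1, ← zext_conj_eq φ, ← hg (y * x)]
          congr 1
          group
      simp only [h3] at h1
      rw [← h2, e] at h1
      exact h1.trans (zext_coe ρ.character 1)
    · rw [← hT.2.2, mem_charKer_indChar_of_isLin hT.isLin] at hg
      rw [mem_charKer_indChar_of_isLin hφ]
      intro x
      obtain ⟨hm, e⟩ := (mem_charKer_iff hT.isLin _).mpr (hg x)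
      rw [zext_of_mem φ (hA hm)]
      refine (congrFun hres ⟨_, hm⟩).trans ?_
      rw [e, hT.2.1]

theorem exists_correspondent (hT : T.IsNLinear N) (hA : T.A ≤ 𝒜) (h𝒜 : NormalIn 𝒜 T.H)
    (hab : AbelianModulo 𝒜 (charKer T.θ)) {R : Set (𝒜 → ℂ)} (hR : T.IsOrbitReps N 𝒜 R)
    {χ : T.H → ℂ} (hχ : χ ∈ IrrTilde N T.H T.θ) :
    ∃ φ ∈ R, ∃ ψ ∈ IrrTilde N (inertia T.H φ) φ, ∃ σ : ℂ ≃+* ℂ, χ = σ ∘ indChar ψ T.H := by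
  have hB : ∀ x ∈ T.H, x ∈ Subgroup.normalizer (𝒜 : Set G) := fun x hx => h𝒜.mem_normalizer hx
  obtain ⟨φ', hφ', hab'⟩ := exists_mem_linTilde hT hA h𝒜 hab hχ
  obtain ⟨φ, ⟨hφR, σ, -, h, hh, hn, e⟩, -⟩ := hR.2 φ' hφ'
  have hφ := isLin_of_mem_linTilde (hR.1 hφR)
  have hirr : σ.symm ∘ χ ∈ Irr T.H := IsIrrChar.galois hχ.1 σ.symm
  have e1 : χ = σ ∘ (σ.symm ∘ χ) := by funext x; simp
  -- `χ` lies above `φ' = σ ∘ φ^h`, so undoing `σ` on `χ` puts it above `φ^h`, hence above `φ`.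
  have habove : LiesAbove (σ.symm ∘ χ) φ := by
    rw [liesAbove_iff h𝒜.1 _ hφ,
      ← pair_conjChar h𝒜.1 (isClassFun_of_mem_irr hirr) φ hn hh]
    rw [liesAbove_iff h𝒜.1 _ (isLin_of_mem_linTilde hφ'), e, e1, Function.comp_assoc,
      pair_comp_ringEquiv] at hab'
    exact fun h0 => hab' (by rw [h0, map_zero])
  obtain ⟨ψ, hψ, habψ, -, eψ⟩ := exists_clifford_correspondent hB h𝒜.1 hφ hirr habove
  refine ⟨φ, hφR, ψ, ⟨hψ, habψ, ?_⟩, σ, by rw [eψ]; exact e1⟩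
  rw [← indChar_indChar (inertia_le T.H φ) le_top, eψ, indChar_comp_ringEquiv,
    charKer_comp_ringEquiv, hχ.2.2]

omit [Finite G] in
theorem ringEquiv_eq_of_mem_adjoin {σ : ℂ ≃+* ℂ} {S : Set ℂ} (h : ∀ z ∈ S, σ z = z) :
    ∀ z ∈ IntermediateField.adjoin ℚ S, σ z = z := by
  intro z hz
  induction hz using IntermediateField.adjoin_induction with
  | mem x hx => exact h x hx
  | algebraMap q => simp
  | add x y _ _ hx hy => rw [map_add, hx, hy]
  | inv x _ hx => rw [map_inv₀, hx]
  | mul x y _ _ hx hy => rw [map_mul, hx, hy]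

theorem eq_of_indChar_eq (hT : T.IsNLinear N) (hA : T.A ≤ 𝒜) (h𝒜 : NormalIn 𝒜 T.H)
    {R : Set (𝒜 → ℂ)} (hR : T.IsOrbitReps N 𝒜 R) {φ₁ φ₂ : 𝒜 → ℂ} (h₁ : φ₁ ∈ R) (h₂ : φ₂ ∈ R)
    {ψ₁ : inertia T.H φ₁ → ℂ} (hψ₁ : ψ₁ ∈ IrrTilde N (inertia T.H φ₁) φ₁)
    {ψ₂ : inertia T.H φ₂ → ℂ} (hψ₂ : ψ₂ ∈ IrrTilde N (inertia T.H φ₂) φ₂)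
    {σ : ℂ ≃+* ℂ} (e : indChar ψ₂ T.H = σ ∘ indChar ψ₁ T.H) : φ₁ = φ₂ := by
  have hB : ∀ x ∈ T.H, x ∈ Subgroup.normalizer (𝒜 : Set G) := fun x hx => h𝒜.mem_normalizer hx
  have hl₁ := isLin_of_mem_linTilde (hR.1 h₁)
  have hl₂ := isLin_of_mem_linTilde (hR.1 h₂)
  obtain ⟨x, hx, ex⟩ := exists_eq_comp_conjChar hB hl₁ hl₂
    (isOver_inertia h𝒜.1 hl₁ hψ₁.1 hψ₁.2.1) (isOver_inertia h𝒜.1 hl₂ hψ₂.1 hψ₂.2.1)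
    (isClassFun_of_mem_irr hψ₂.1) (apply_one_ne_zero hψ₂.1) σ e h𝒜.1
  -- Both `φ₁` and `φ₂` extend the `H`-invariant `θ`, so comparing on `A` shows that `σ` fixes the
  -- values of `θ`, as `SameOrbit` demands.
  have hfix : ∀ z ∈ Set.range T.θ, σ z = z := by
    rintro _ ⟨a, rfl⟩
    obtain ⟨hn, ea⟩ := hT.1.2.2 x hx
    have h3 := zext_eq_of_mem_linTilde hT hA h𝒜.1 (hR.1 h₂) a
    rw [ex, zext_comp_conjChar] at h3
    have h4 := zext_eq_of_mem_linTilde hT hA h𝒜.1 (hR.1 h₁)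
      ⟨x * a * x⁻¹, (Subgroup.mem_normalizer_iff.mp hn a).mp a.2⟩
    rw [h4] at h3
    have h5 := congrFun ea a
    unfold conjChar at h5
    rwa [h5] at h3
  refine (hR.2 φ₂ (hR.1 h₂)).unique
    ⟨h₁, σ, ringEquiv_eq_of_mem_adjoin hfix, x, hx, hB x hx, ex⟩
    ⟨h₂, RingEquiv.refl ℂ, fun _ _ => rfl, 1, one_mem _, one_mem _, ?_⟩
  funext b
  simp [conjChar]

theorem exists_eq_of_indChar_eq (h𝒜 : NormalIn 𝒜 T.H) {φ : 𝒜 → ℂ} (hφ : IsLin φ)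
    {ψ₁ ψ₂ : inertia T.H φ → ℂ} (hψ₁ : ψ₁ ∈ IrrTilde N (inertia T.H φ) φ)
    (hψ₂ : ψ₂ ∈ IrrTilde N (inertia T.H φ) φ) {σ : ℂ ≃+* ℂ}
    (e : indChar ψ₂ T.H = σ ∘ indChar ψ₁ T.H) :
    ∃ x ∈ T.H ⊓ Subgroup.normalizer (charKer φ),
      ∃ hx : x ∈ Subgroup.normalizer ((inertia T.H φ : Subgroup G) : Set G),
        ψ₂ = σ ∘ conjChar ψ₁ x hx := by
  have hB : ∀ x ∈ T.H, x ∈ Subgroup.normalizer (𝒜 : Set G) := fun x hx => h𝒜.mem_normalizer hx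
  have ho₁ := isOver_inertia h𝒜.1 hφ hψ₁.1 hψ₁.2.1
  have ho₂ := isOver_inertia h𝒜.1 hφ hψ₂.1 hψ₂.2.1
  have hc₂ := isClassFun_of_mem_irr hψ₂.1
  obtain ⟨x, hx, ex⟩ := exists_eq_comp_conjChar hB hφ hφ ho₁ ho₂ hc₂ (apply_one_ne_zero hψ₂.1) σ
    e h𝒜.1
  have hxN : x ∈ T.H ⊓ Subgroup.normalizer (charKer φ) :=
    ⟨hx, mem_normalizer_charKer hφ (hB x hx) ex⟩
  have hxI := (normalIn_inertia hφ h𝒜).mem_normalizer hxN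
  -- `ψ₂` and `σ ∘ ψ₁^x` both lie over `φ = σ ∘ φ^x` and induce the same character of `H`, so
  -- injectivity of induction identifies them.
  refine ⟨x, hxN, hxI, indChar_injective hB hφ hc₂ ho₂ ?_ ?_ ?_⟩
  · intro y g
    exact congrArg σ ((isClassFun_of_mem_irr hψ₁.1).conjChar hxI y g)
  · have := ho₁.comp_conjChar σ (hB x hx) hxI
    rwa [← ex] at this
  · rw [e, indChar_comp_conjChar σ ψ₁ hxI hx]

omit [Finite G] in
theorem mem_of_mem_Cl {R : Set (𝒜 → ℂ)} {φ : 𝒜 → ℂ}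
    (h : (⟨inertia T.H φ, 𝒜, φ⟩ : Triple G) ∈ T.Cl 𝒜 R) : φ ∈ R := by
  obtain ⟨-, φ', hφ', e⟩ := h
  have := (Triple.mk.inj e).2.2
  rwa [eq_of_heq this]

end Triples

end NLin

open NLin
theorem theorem3p1 {G : Type*} [Group G] [Finite G] (hG : InClassC G)
    (N : Subgroup G) (hN : N.Normal)
    (T : Triple G) (hT : T.IsNLinear N) (hHA : T.H ≠ T.A)
    (𝒜 : Subgroup G) (h𝒜 : T.IsMaxAbelianNormal 𝒜)
    (R : Set (𝒜 → ℂ)) (hR : T.IsOrbitReps N 𝒜 R) :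
    -- (i)
    (∀ φ : 𝒜 → ℂ, (⟨inertia T.H φ, 𝒜, φ⟩ : Triple G) ∈ T.Cl 𝒜 R →
      -- (a)
      (T.A < 𝒜 ∧
        ((𝒜 = T.H ∧ T.H = inertia T.H φ) ↔ AbelianModulo T.H (charKer T.θ))) ∧
      -- (b)
      NormalIn (inertia T.H φ) (T.H ⊓ Subgroup.normalizer (charKer φ)) ∧
      -- (c)
      Set.MapsTo (fun ψ : inertia T.H φ → ℂ => indChar ψ T.H)
        (IrrTilde N (inertia T.H φ) φ) (IrrTilde N T.H T.θ) ∧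
      Set.InjOn (fun ψ : inertia T.H φ → ℂ => indChar ψ T.H)
        (IrrTilde N (inertia T.H φ) φ)) ∧
    -- (ii)
    (∀ χ ∈ IrrTilde N T.H T.θ,
      ∃ φ : 𝒜 → ℂ, (⟨inertia T.H φ, 𝒜, φ⟩ : Triple G) ∈ T.Cl 𝒜 R ∧
        ∃ ψ ∈ IrrTilde N (inertia T.H φ) φ, ∃ σ : ℂ ≃+* ℂ, χ = σ ∘ indChar ψ T.H) ∧
    -- (iii): first the equality of the two correspondents, then the comparison over a common `φ`
    (∀ φ₁ φ₂ : 𝒜 → ℂ, (⟨inertia T.H φ₁, 𝒜, φ₁⟩ : Triple G) ∈ T.Cl 𝒜 R →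
      (⟨inertia T.H φ₂, 𝒜, φ₂⟩ : Triple G) ∈ T.Cl 𝒜 R →
      ∀ ψ₁ ∈ IrrTilde N (inertia T.H φ₁) φ₁, ∀ ψ₂ ∈ IrrTilde N (inertia T.H φ₂) φ₂,
      ∀ σ : ℂ ≃+* ℂ, indChar ψ₂ T.H = σ ∘ indChar ψ₁ T.H → φ₁ = φ₂) ∧
    (∀ φ : 𝒜 → ℂ, (⟨inertia T.H φ, 𝒜, φ⟩ : Triple G) ∈ T.Cl 𝒜 R →
      ∀ ψ₁ ∈ IrrTilde N (inertia T.H φ) φ, ∀ ψ₂ ∈ IrrTilde N (inertia T.H φ) φ,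
      ∀ σ : ℂ ≃+* ℂ, indChar ψ₂ T.H = σ ∘ indChar ψ₁ T.H →
        ∃ x ∈ T.H ⊓ Subgroup.normalizer (charKer φ),
          ∃ hx : x ∈ Subgroup.normalizer ((inertia T.H φ : Subgroup G) : Set G),
            ψ₂ = σ ∘ conjChar ψ₁ x hx) := by
  have hlt := h𝒜.lt hG hT.1 hT.isLin hHA
  have hn := h𝒜.1.1
  refine ⟨fun φ hφ => ?_, fun χ hχ => ?_, fun φ₁ φ₂ h₁ h₂ ψ₁ hψ₁ ψ₂ hψ₂ σ e => ?_,
    fun φ hφ ψ₁ hψ₁ ψ₂ hψ₂ σ e => ?_⟩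
  · have hm := hR.1 (mem_of_mem_Cl hφ)
    have hl := isLin_of_mem_linTilde hm
    exact ⟨⟨hlt, h𝒜.eq_iff hT.1 hl⟩, normalIn_inertia hl hn, mapsTo_indChar hT hlt.le hn hm,
      injOn_indChar hn hl⟩
  · obtain ⟨φ, hφ, ψ, hψ, σ, e⟩ := exists_correspondent hT hlt.le hn h𝒜.1.2.2 hR hχ
    exact ⟨φ, ⟨hHA, φ, hφ, rfl⟩, ψ, hψ, σ, e⟩
  · exact eq_of_indChar_eq hT hlt.le hn hR (mem_of_mem_Cl h₁) (mem_of_mem_Cl h₂) hψ₁ hψ₂ e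
  · exact exists_eq_of_indChar_eq hn (isLin_of_mem_linTilde (hR.1 (mem_of_mem_Cl hφ))) hψ₁ hψ₂ e
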